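/- Let $\kappa>0$, $n\in\{1,2,\dots\}$, $\nu\in\{1,-1\}$, $B=\int_0^1\frac{d\theta}{\sqrt{\theta^{-4}-1}}$, and consider, for $\lambda\in\mathbb R$, the problem $$-u''=\lambda u\,[1+\kappa (u')^2]^{3/2}\ \text{ in } (0,1),\qquad u(0)=u(1)=0, \tag{$*$}$$ equivalently $-\big(u'/\sqrt{1+\kappa (u')^2}\big)'=\lambda u$, $u(0)=u(1)=0$. Let $S_n^\nu$ be the set of all $u\in C^1[0,1]$ with $u(0)=u(1)=0$ that have exactly $n-1$ zeros in $(0,1)$, all of them simple, and for which $\nu u$ is positive near $0$ (on some interval $(0,\delta)$). An $S_n^\nu$-solution is a $u\in S_n^\nu$, twice differentiable in $(0,1)$, that satisfies $(*)$. Then: 1. Problem $(*)$ has an $S_n^\nu$-solution if and only if $8n^2B^2<\lambda<n^2\pi^2$. 2. For each $\lambda$ the $S_n^\nu$-solution is unique if it exists; it is denoted by $u_\lambda$. 3. For all $\lambda\in(8n^2B^2,n^2\pi^2)$ the zeros of $u_\lambda$ in $[0,1]$ are exactly the points $j/n$, $0\le j\le n$; all humps are the same, i.e. $u_\lambda(\frac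 jn+x)=(-1)^j u_\lambda(x)$ for $0\le j<n$ and $0\le x\le\frac1n$; and the first hump is symmetric around $\frac1{2n}$, i.e. $u_\lambda(\frac1n-x)=u_\lambda(x)$ for $0\le x\le \frac1n$. 4. $\nu\, u_\lambda'(0)$ is a strictly decreasing function of $\lambda\in(8n^2B^2,n^2\pi^2)$, and $\lim_{\lambda\downarrow 8n^2B^2}\nu\,u_\lambda'(0)=\infty$. 5. $\lambda\mapsto\|u_\lambda\|_\infty$ is differentiable and strictly decreasing on $(8n^2B^2,n^2\pi^2)$, with $$\lim_{\lambda\downarrow 8n^2B^2}\|u_\lambda\|_\infty=\frac1{2nB\sqrt\kappa},\qquad \lim_{\lambda\uparrow n^2\pi^2}\|u_\lambda\|_\infty=\lim_{\lambda\uparrow n^2\pi^2}u_\lambda\big(\tfrac1{2n}\big)=0.$$ 6. The pointwise limit $U:=\lim_{\lambda\downarrow 8n^2B^2}u_\lambda$ exists on $[0,1]$. It is a solution for $\lambda=8n^2B^2$ that is singular at the points $j/n$: $U$ is continuous on $[0,1]$, $U(0)=U(1)=0$, $U$ is twice differentiable and satisfies the differential equation in $(*)$ (with $\lambda=8n^2B^2$)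 at every point of $(0,1)$ other than the points $j/n$, and $$\nu(-1)^jU'(\tfrac jn)=\infty,\qquad j=0,1,\dots,n,$$ in the sense that both the difference quotients of $\nu(-1)^jU$ at $\frac jn$ and the derivatives $\nu(-1)^jU'(x)$ tend to $+\infty$ as $x\to\frac jn$, $x \neq \frac jn$, within $(0,1)$ (from one side if $j\in\{0,n\}$). -/

import Mathlib

open Set Filter Topology

noncomputable section

namespace Curvature

/-- The constant `B = ∫₀¹ dθ / √(θ⁻⁴ - 1)`. -/
def B : ℝ := ∫ θ in (0 : ℝ)..1, 1 / √(θ ^ (-4 : ℤ) - 1)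

/-- The sup-norm on `[0,1]`. -/
def supNorm (u : ℝ → ℝ) : ℝ := sSup ((fun x => |u x|) '' Icc 0 1)

/-- The equation `-u'' = lam * u * (1 + κ (u')²)^(3/2)` holds at the point `x`
(in particular `u` is differentiable and `u'` is differentiable there). -/
def SolvesAt (κ lam : ℝ) (u : ℝ → ℝ) (x : ℝ) : Prop :=
  DifferentiableAt ℝ u x ∧
    HasDerivAt (deriv u) (-(lam * u x * (1 + κ * (deriv u x) ^ 2) ^ (3 / 2 : ℝ))) x

/-- A function (only its values on `[0,1]` matter) in `C¹[0,1]` vanishing at `0` and `1`. -/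
def MemC10 (u : ℝ → ℝ) : Prop :=
  ContDiffOn ℝ 1 u (Icc 0 1) ∧ u 0 = 0 ∧ u 1 = 0

/-- The nodal class `S_n^ν` (`ν = 1` or `ν = -1`): functions of `C¹₀[0,1]` with exactly `n - 1`
zeros in `(0,1)`, all of them simple, such that `ν u` is positive near `0`. -/
def NodalClass (n : ℕ) (ν : ℝ) : Set (ℝ → ℝ) :=
  {u | MemC10 u ∧ {x ∈ Ioo (0 : ℝ) 1 | u x = 0}.encard = ((n - 1 : ℕ) : ℕ∞) ∧
    (∀ x ∈ Ioo (0 : ℝ) 1, u x = 0 → deriv u x ≠ 0) ∧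
    ∀ᶠ x in 𝓝[>] (0 : ℝ), 0 < ν * u x}

/-- `u` is a classical solution, lying in `S_n^ν`, of the Dirichlet problem on `(0,1)`. -/
def IsNodalSolution (κ lam : ℝ) (n : ℕ) (ν : ℝ) (u : ℝ → ℝ) : Prop :=
  u ∈ NodalClass n ν ∧ ∀ x ∈ Ioo (0 : ℝ) 1, SolvesAt κ lam u x

/-- The derivative of `u` on `[0,1]` is `+∞` at `a`, both as the limit of the difference
quotients at `a` and as the limit of `u'(x)` as `x → a` (one-sided if `a` is `0` or `1`). -/
def HasDerivTop (u : ℝ → ℝ) (a : ℝ) : Prop :=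
  Tendsto (slope u a) (𝓝[Icc 0 1 \ {a}] a) atTop ∧
    Tendsto (deriv u) (𝓝[Ioo 0 1 \ {a}] a) atTop

/-- `u` is a solution on `[0,1]` of the Dirichlet problem, continuous on `[0,1]`, which satisfies
the equation in `(0,1)` except at the points of the set `Z`. -/
def IsSolutionOff (κ lam : ℝ) (Z : Set ℝ) (u : ℝ → ℝ) : Prop :=
  ContinuousOn u (Icc 0 1) ∧ u 0 = 0 ∧ u 1 = 0 ∧ ∀ x ∈ Ioo (0 : ℝ) 1 \ Z, SolvesAt κ lam u x

/-- The points `j/n`, `j = 0, …, n`. -/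
def nodes (n : ℕ) : Set ℝ := {x | ∃ j : ℕ, j ≤ n ∧ x = (j : ℝ) / n}

end Curvature

end

/-!
The solutions are written down explicitly. Along a solution of amplitude `M` the quantity
`1 / √(1 + κ u'²) - κ lam u² / 2` is constant; calling this constant `1 - m`, so that
`m = κ lam M² / 2`, and writing `u = M sin t`, one gets `1 / √(1 + κ u'²) = 1 - m cos² t`, and
`x` is, up to the factor `√(2 / lam)`, the integral over the angle `t` of the smooth function
`density m t = (1 - m cos² t) / √(2 - m cos² t)`. This integral, `abscissa m`, is strictly
increasing for all `m ∈ [0, 1]` and commutes with translations by `π`, so its inverse `angle m`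
yields the wave `u = M sin (angle m (k x + c))`, with `k = √(lam / 2)`, on the whole line. It has
equal symmetric humps by construction. For `m < 1` it is a `C¹` solution (`solvesAt_wave`); for
`m = 1` the density vanishes at the multiples of `π`, where the slope becomes infinite
(`hasDerivTop_nodalWave`).

Conversely, for `lam ≤ 0` the square of a solution is convex, hence zero
(`eqOn_zero_of_nonpos`). For `lam > 0` the wave through the same point of the phase plane exists
(`exists_wave_data`), and uniqueness for the initial value problem identifies it with the given
solution (`IsNodalSolution.exists_nodalWave`). The boundary conditions and the number of zeros say
that `k = n * hump m`, where `hump m = abscissa m π`, that is, `lam = 2 (n * hump m)²` with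
`0 < m < 1`.

Everything else is the behaviour of `hump`: it is strictly decreasing on `[0, 1]` with negative
derivative in the interior (`exists_hasDerivAt_hump`), `hump 0 = π / √2`, and `hump 1 = 2 B`. So
`m` is a differentiable, strictly decreasing function of `lam`, which runs from `1` to `0`, and the
slope at `0` and the sup-norm are explicit increasing functions of `m`. The limits at the two ends
follow from continuity of `hump` and `angle` up to `m = 0` and `m = 1`, which is a matter of
inverting continuous injections on compact sets (`tendsto_of_tendsto_comp`).
-/

namespace Curvature

/-! ### Compactness -/

/-- A continuous injection on a compact set reflects convergence. -/
theorem tendsto_of_tendsto_comp {ι X Y : Type*} [TopologicalSpace X] [TopologicalSpace Y]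
    [T2Space Y] {K : Set X} (hK : IsCompact K) {f : X → Y} (hf : ContinuousOn f K)
    (hinj : InjOn f K) {l : Filter ι} {g : ι → X} {x : X} (hx : x ∈ K)
    (hg : ∀ᶠ i in l, g i ∈ K) (h : Tendsto (fun i => f (g i)) l (𝓝 (f x))) :
    Tendsto g l (𝓝 x) := by
  rw [tendsto_iff_ultrafilter]
  intro U hU
  have hgU : ∀ᶠ i in (U : Filter ι), g i ∈ K := hU hg
  obtain ⟨y, hy, hUy⟩ := hK.ultrafilter_le_nhds (U.map g) (le_principal_iff.2 hgU)
  have h1 : Tendsto g U (𝓝[K] y) := tendsto_nhdsWithin_iff.2 ⟨hUy, hgU⟩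
  have h2 := (hf y hy).tendsto.comp h1
  have h3 : f y = f x := tendsto_nhds_unique h2 (h.mono_left hU)
  have h4 := hinj hy hx h3
  exact h4 ▸ hUy

/-! ### The arc length integral -/

/-- The derivative of the rescaled abscissa with respect to the angle `t`, along the solution
`u = M sin t` with `κ λ M² / 2 = m`. -/
noncomputable def density (m t : ℝ) : ℝ := (1 - m * Real.cos t ^ 2) / √(2 - m * Real.cos t ^ 2)

/-- The rescaled abscissa as a function of the angle `t`. -/
noncomputable def abscissa (m t : ℝ) : ℝ := ∫ s in (0 : ℝ)..t, density m s

/-- The rescaled length of one hump. -/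
noncomputable def hump (m : ℝ) : ℝ := abscissa m Real.pi

theorem mul_cos_sq_le {m : ℝ} (hm : m ∈ Icc (0 : ℝ) 1) (t : ℝ) : m * Real.cos t ^ 2 ≤ 1 :=
  mul_le_one₀ hm.2 (sq_nonneg _) (Real.cos_sq_le_one t)

theorem one_sub_mul_cos_sq_pos {m : ℝ} (hm : m ∈ Icc (0 : ℝ) 1) {t : ℝ}
    (h : m < 1 ∨ Real.sin t ≠ 0) : 0 < 1 - m * Real.cos t ^ 2 := by
  rcases h with h | h
  · nlinarith [Real.cos_sq_le_one t, hm.1, sq_nonneg (Real.cos t)]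
  · have := Real.sin_sq_add_cos_sq t
    have : 0 < Real.sin t ^ 2 := by positivity
    nlinarith [hm.2, sq_nonneg (Real.cos t)]

theorem density_nonneg {m : ℝ} (hm : m ∈ Icc (0 : ℝ) 1) (t : ℝ) : 0 ≤ density m t :=
  div_nonneg (by linarith [mul_cos_sq_le hm t]) (Real.sqrt_nonneg _)

theorem density_pos {m : ℝ} (hm : m ∈ Icc (0 : ℝ) 1) {t : ℝ}
    (h : m < 1 ∨ Real.sin t ≠ 0) : 0 < density m t :=
  div_pos (one_sub_mul_cos_sq_pos hm h) (Real.sqrt_pos.2 (by linarith [mul_cos_sq_le hm t]))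

theorem continuous_density_uncurry :
    Continuous (Function.uncurry fun (m : Icc (0 : ℝ) 1) (t : ℝ) => density m t) := by
  unfold density Function.uncurry
  refine Continuous.div (by fun_prop) (by fun_prop) fun x => ?_
  exact (Real.sqrt_pos.2 (by linarith [mul_cos_sq_le x.1.2 x.2])).ne'

theorem continuous_density {m : ℝ} (hm : m ∈ Icc (0 : ℝ) 1) : Continuous (density m) :=
  continuous_density_uncurry.comp (Continuous.prodMk_right (⟨m, hm⟩ : Icc (0 : ℝ) 1))

theorem intervalIntegrable_density {m : ℝ} (hm : m ∈ Icc (0 : ℝ) 1) (a b : ℝ) :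
    IntervalIntegrable (density m) MeasureTheory.volume a b :=
  (continuous_density hm).intervalIntegrable _ _

theorem continuousOn_abscissa :
    ContinuousOn (fun p : ℝ × ℝ => abscissa p.1 p.2) (Icc 0 1 ×ˢ univ) := by
  have h := intervalIntegral.continuous_parametric_intervalIntegral_of_continuous
    (μ := MeasureTheory.volume) (a₀ := (0 : ℝ))
    (f := fun (p : Icc (0 : ℝ) 1 × ℝ) (t : ℝ) => density p.1 t)
    (continuous_density_uncurry.comp
      ((continuous_fst.comp continuous_fst).prodMk continuous_snd)) continuous_snd
  rw [continuousOn_iff_continuous_domRestrict]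
  exact h.comp (((continuous_fst.comp continuous_subtype_val).subtype_mk
    (p := (· ∈ Icc (0 : ℝ) 1)) fun p => p.2.1).prodMk (continuous_snd.comp continuous_subtype_val))

theorem hasDerivAt_abscissa {m : ℝ} (hm : m ∈ Icc (0 : ℝ) 1) (t : ℝ) :
    HasDerivAt (abscissa m) (density m t) t :=
  (continuous_density hm).integral_hasStrictDerivAt 0 t |>.hasDerivAt

theorem continuous_abscissa {m : ℝ} (hm : m ∈ Icc (0 : ℝ) 1) : Continuous (abscissa m) :=
  continuous_iff_continuousAt.2 fun t => (hasDerivAt_abscissa hm t).continuousAt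

theorem abscissa_zero (m : ℝ) : abscissa m 0 = 0 := by simp [abscissa]

theorem exists_sin_ne_zero {a b : ℝ} (hab : a < b) : ∃ c ∈ Icc a b, Real.sin c ≠ 0 := by
  by_cases h : Real.sin a = 0
  · refine ⟨min b (a + Real.pi / 2), ⟨le_min hab.le (by linarith [Real.pi_pos]),
      min_le_left _ _⟩, ?_⟩
    have h1 : Real.cos a ≠ 0 := fun h' => by
      have := Real.sin_sq_add_cos_sq a
      simp [h, h'] at this
    have h2 : 0 < min b (a + Real.pi / 2) - a :=
      sub_pos.2 (lt_min hab (by linarith [Real.pi_pos]))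
    have h3 : min b (a + Real.pi / 2) - a < Real.pi := by
      linarith [min_le_right b (a + Real.pi / 2), Real.pi_pos]
    have h4 := Real.sin_pos_of_pos_of_lt_pi h2 h3
    have h5 : min b (a + Real.pi / 2) = a + (min b (a + Real.pi / 2) - a) := by ring
    rw [h5, Real.sin_add, h, zero_mul, zero_add]
    exact mul_ne_zero h1 h4.ne'
  · exact ⟨a, ⟨le_rfl, hab.le⟩, h⟩

theorem strictMono_abscissa {m : ℝ} (hm : m ∈ Icc (0 : ℝ) 1) : StrictMono (abscissa m) := by
  intro a b hab
  have h1 : abscissa m b - abscissa m a = ∫ s in a..b, density m s :=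
    intervalIntegral.integral_interval_sub_left (intervalIntegrable_density hm _ _)
      (intervalIntegrable_density hm _ _)
  obtain ⟨c, hc, hs⟩ := exists_sin_ne_zero hab
  have h2 : 0 < ∫ s in a..b, density m s :=
    intervalIntegral.integral_pos hab (continuous_density hm).continuousOn
      (fun x _ => density_nonneg hm x) ⟨c, hc, density_pos hm (Or.inr hs)⟩
  linarith

theorem periodic_density (m : ℝ) : Function.Periodic (density m) Real.pi := fun t => by
  simp [density, Real.cos_add_pi]

theorem abscissa_add_int_mul_pi {m : ℝ} (hm : m ∈ Icc (0 : ℝ) 1) (t : ℝ) (j : ℤ) :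
    abscissa m (t + j * Real.pi) = abscissa m t + j * hump m := by
  have h1 := intervalIntegral.integral_add_adjacent_intervals
    (intervalIntegrable_density hm 0 (j * Real.pi))
    (intervalIntegrable_density hm (j * Real.pi) (t + j * Real.pi))
  have h2 := (periodic_density m).intervalIntegral_add_zsmul_eq j 0
    (fun a b => intervalIntegrable_density hm a b)
  have h3 : ∫ s in (j * Real.pi)..(t + j * Real.pi), density m s = ∫ s in (0 : ℝ)..t, density m s := by
    have := intervalIntegral.integral_comp_add_right (a := 0) (b := t) (density m) (j * Real.pi)
    rw [zero_add] at this
    rw [← this]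
    congr 1
    ext s
    simpa using (periodic_density m).int_mul j s
  simp only [zero_add, zsmul_eq_mul] at h2
  unfold hump abscissa
  rw [← h1, h2, h3, add_comm]

theorem abscissa_pi_sub {m : ℝ} (hm : m ∈ Icc (0 : ℝ) 1) (t : ℝ) :
    abscissa m (Real.pi - t) = hump m - abscissa m t := by
  have h1 := intervalIntegral.integral_comp_sub_left (a := 0) (b := t) (density m) Real.pi
  have h2 : (fun s => density m (Real.pi - s)) = density m := by
    ext s
    simp [density, Real.cos_pi_sub]
  rw [h2, sub_zero] at h1
  have h3 := intervalIntegral.integral_add_adjacent_intervals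
    (intervalIntegrable_density hm 0 (Real.pi - t))
    (intervalIntegrable_density hm (Real.pi - t) Real.pi)
  unfold hump abscissa
  rw [h1, ← h3]
  ring

theorem hump_pos {m : ℝ} (hm : m ∈ Icc (0 : ℝ) 1) : 0 < hump m := by
  have := strictMono_abscissa hm Real.pi_pos
  rwa [abscissa_zero] at this

theorem surjective_abscissa {m : ℝ} (hm : m ∈ Icc (0 : ℝ) 1) :
    Function.Surjective (abscissa m) := by
  have hi := intervalIntegrable_density hm
  refine (continuous_abscissa hm).surjective ?_ ?_
  · exact (periodic_density m).tendsto_atTop_intervalIntegral_of_pos (hump_pos hm) Real.pi_pos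
  · exact (periodic_density m).tendsto_atBot_intervalIntegral_of_pos (hump_pos hm) Real.pi_pos

/-! ### The angle as a function of the abscissa -/

/-- The angle at which the rescaled abscissa takes a given value: the inverse function of
`abscissa m`, meaningful for `0 ≤ m ≤ 1`. -/
noncomputable def angle (m : ℝ) : ℝ → ℝ := Function.invFun (abscissa m)

theorem abscissa_angle {m : ℝ} (hm : m ∈ Icc (0 : ℝ) 1) (y : ℝ) : abscissa m (angle m y) = y :=
  Function.rightInverse_invFun (surjective_abscissa hm) y

theorem angle_abscissa {m : ℝ} (hm : m ∈ Icc (0 : ℝ) 1) (t : ℝ) : angle m (abscissa m t) = t :=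
  Function.leftInverse_invFun (strictMono_abscissa hm).injective t

theorem strictMono_angle {m : ℝ} (hm : m ∈ Icc (0 : ℝ) 1) : StrictMono (angle m) := fun a b h => by
  rw [← (strictMono_abscissa hm).lt_iff_lt, abscissa_angle hm, abscissa_angle hm]
  exact h

theorem continuous_angle {m : ℝ} (hm : m ∈ Icc (0 : ℝ) 1) : Continuous (angle m) :=
  (strictMono_angle hm).monotone.continuous_of_surjective fun t => ⟨_, angle_abscissa hm t⟩

theorem angle_eq {m : ℝ} (hm : m ∈ Icc (0 : ℝ) 1) {y t : ℝ} (h : abscissa m t = y) :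
    angle m y = t := h ▸ angle_abscissa hm t

theorem angle_zero {m : ℝ} (hm : m ∈ Icc (0 : ℝ) 1) : angle m 0 = 0 :=
  angle_eq hm (abscissa_zero m)

theorem angle_add_int_mul_hump {m : ℝ} (hm : m ∈ Icc (0 : ℝ) 1) (y : ℝ) (j : ℤ) :
    angle m (y + j * hump m) = angle m y + j * Real.pi :=
  angle_eq hm (by rw [abscissa_add_int_mul_pi hm, abscissa_angle hm])

theorem angle_int_mul_hump {m : ℝ} (hm : m ∈ Icc (0 : ℝ) 1) (j : ℤ) :
    angle m (j * hump m) = j * Real.pi := by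
  simpa [angle_zero hm] using angle_add_int_mul_hump hm 0 j

theorem angle_hump_sub {m : ℝ} (hm : m ∈ Icc (0 : ℝ) 1) (y : ℝ) :
    angle m (hump m - y) = Real.pi - angle m y :=
  angle_eq hm (by rw [abscissa_pi_sub hm, abscissa_angle hm])

theorem angle_half_hump {m : ℝ} (hm : m ∈ Icc (0 : ℝ) 1) :
    angle m (hump m / 2) = Real.pi / 2 := by
  have := angle_hump_sub hm (hump m / 2)
  rw [sub_half] at this
  linarith

theorem sin_angle_eq_zero_iff {m : ℝ} (hm : m ∈ Icc (0 : ℝ) 1) {y : ℝ} :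
    Real.sin (angle m y) = 0 ↔ ∃ j : ℤ, y = j * hump m := by
  rw [Real.sin_eq_zero_iff]
  refine exists_congr fun j => ?_
  rw [← angle_int_mul_hump hm, (strictMono_angle hm).injective.eq_iff, eq_comm]

theorem hasDerivAt_angle {m : ℝ} (hm : m ∈ Icc (0 : ℝ) 1) {y : ℝ}
    (h : m < 1 ∨ Real.sin (angle m y) ≠ 0) :
    HasDerivAt (angle m) (density m (angle m y))⁻¹ y :=
  (hasDerivAt_abscissa hm _).of_local_left_inverse (continuous_angle hm).continuousAt
    (density_pos hm h).ne' (Eventually.of_forall (abscissa_angle hm))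

/-! ### The length of a hump -/

/-- The derivative of `density` with respect to the parameter `m`. -/
noncomputable def densityDeriv (m t : ℝ) : ℝ :=
  -(Real.cos t ^ 2 * (3 - m * Real.cos t ^ 2) / (2 * √(2 - m * Real.cos t ^ 2) ^ 3))

theorem hasDerivAt_density {m : ℝ} (hm : m ∈ Icc (0 : ℝ) 1) (t : ℝ) :
    HasDerivAt (fun m => density m t) (densityDeriv m t) m := by
  have h2 : 0 < 2 - m * Real.cos t ^ 2 := by linarith [mul_cos_sq_le hm t]
  have h3 := Real.sqrt_pos.2 h2
  have hd : ∀ c : ℝ, HasDerivAt (fun m : ℝ => c - m * Real.cos t ^ 2) (-(Real.cos t ^ 2)) m :=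
    fun c => by simpa using ((hasDerivAt_id m).mul_const (Real.cos t ^ 2)).const_sub c
  have h := (hd 1).div ((hd 2).sqrt h2.ne') h3.ne'
  refine h.congr_deriv ?_
  have h4 := Real.sq_sqrt h2.le
  unfold densityDeriv
  field_simp
  rw [mul_comm m] at h4
  rw [h4]
  ring

theorem continuous_densityDeriv {m : ℝ} (hm : m ∈ Icc (0 : ℝ) 1) :
    Continuous (densityDeriv m) := by
  unfold densityDeriv
  refine (Continuous.div (by fun_prop) (by fun_prop) fun t => ?_).neg
  have := Real.sqrt_pos.2 (by linarith [mul_cos_sq_le hm t] : 0 < 2 - m * Real.cos t ^ 2)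
  positivity

theorem abs_densityDeriv_le {m : ℝ} (hm : m ∈ Icc (0 : ℝ) 1) (t : ℝ) :
    |densityDeriv m t| ≤ 3 / 2 := by
  have h1 : 1 ≤ √(2 - m * Real.cos t ^ 2) :=
    Real.one_le_sqrt.2 (by linarith [mul_cos_sq_le hm t])
  have h2 : 1 ≤ √(2 - m * Real.cos t ^ 2) ^ 3 := one_le_pow₀ h1
  have h3 := Real.cos_sq_le_one t
  have h4 := mul_cos_sq_le hm t
  have h5 : 0 ≤ m * Real.cos t ^ 2 := mul_nonneg hm.1 (sq_nonneg _)
  unfold densityDeriv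
  rw [abs_neg, abs_of_nonneg (div_nonneg (mul_nonneg (sq_nonneg _) (by linarith)) (by positivity)),
    div_le_div_iff₀ (by positivity) two_pos]
  nlinarith [sq_nonneg (Real.cos t)]

theorem exists_hasDerivAt_hump {m : ℝ} (hm : m ∈ Ioo (0 : ℝ) 1) :
    ∃ d < 0, HasDerivAt hump d m := by
  have hm' := Ioo_subset_Icc_self hm
  have hmem : Ioo (0 : ℝ) 1 ∈ 𝓝 m := isOpen_Ioo.mem_nhds hm
  obtain ⟨-, h⟩ := intervalIntegral.hasDerivAt_integral_of_dominated_loc_of_deriv_le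
    (μ := MeasureTheory.volume) (a := 0) (b := Real.pi) (F := density) (F' := densityDeriv)
    (bound := fun _ => 3 / 2) hmem
    (eventually_of_mem hmem fun x hx =>
      (continuous_density (Ioo_subset_Icc_self hx)).aestronglyMeasurable)
    (intervalIntegrable_density hm' _ _) (continuous_densityDeriv hm').aestronglyMeasurable
    (Eventually.of_forall fun t _ x hx => abs_densityDeriv_le (Ioo_subset_Icc_self hx) t)
    (by simp) (Eventually.of_forall fun t _ x hx => hasDerivAt_density (Ioo_subset_Icc_self hx) t)
  refine ⟨_, ?_, h⟩
  have hpos : 0 < ∫ t in (0 : ℝ)..Real.pi, -densityDeriv m t := by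
    have hnn : ∀ t, 0 < 3 - m * Real.cos t ^ 2 := fun t => by linarith [mul_cos_sq_le hm' t]
    refine intervalIntegral.integral_pos Real.pi_pos (continuous_densityDeriv hm').neg.continuousOn
      (fun t _ => ?_) ⟨0, ⟨le_rfl, Real.pi_pos.le⟩, ?_⟩
    · have := hnn t
      rw [densityDeriv, neg_neg]
      positivity
    · have := Real.sqrt_pos.2 (by linarith [hm.2] : 0 < 2 - m)
      have h3 : 0 < 3 - m := by linarith [hm.2]
      simp only [densityDeriv, Real.cos_zero, neg_neg, one_pow, mul_one, one_mul]
      positivity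
  rw [intervalIntegral.integral_neg] at hpos
  linarith

theorem continuousOn_hump : ContinuousOn hump (Icc 0 1) :=
  continuousOn_abscissa.comp (f := fun m => (m, Real.pi)) (by fun_prop) fun _ hm => ⟨hm, mem_univ _⟩

theorem strictAntiOn_hump : StrictAntiOn hump (Icc 0 1) := by
  refine strictAntiOn_of_deriv_neg (convex_Icc 0 1) continuousOn_hump fun m hm => ?_
  rw [interior_Icc] at hm
  obtain ⟨d, hd, h⟩ := exists_hasDerivAt_hump hm
  rwa [h.deriv]

theorem hump_zero : hump 0 = Real.pi / √2 := by
  simp [hump, abscissa, density, div_eq_mul_inv]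

/-- The substitution `θ = sin t` in the integral `B`; the change of variables formula on the open
interval needs no integrability at the singular end point. -/
theorem hump_one : hump 1 = 2 * B := by
  have hm : (1 : ℝ) ∈ Icc (0 : ℝ) 1 := ⟨zero_le_one, le_rfl⟩
  have h1 : hump 1 = 2 * abscissa 1 (Real.pi / 2) := by
    have := abscissa_pi_sub hm (Real.pi / 2)
    rw [sub_half] at this
    linarith
  have himg : Real.sin '' Ioo 0 (Real.pi / 2) = Ioo 0 1 := by
    refine Subset.antisymm ?_ ?_
    · rintro _ ⟨t, ht, rfl⟩
      refine ⟨Real.sin_pos_of_pos_of_lt_pi ht.1 (by linarith [ht.2, Real.pi_pos]), ?_⟩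
      rw [← Real.sin_pi_div_two]
      exact Real.sin_lt_sin_of_lt_of_le_pi_div_two (by linarith [ht.1, Real.pi_pos]) le_rfl ht.2
    · intro x hx
      exact ⟨Real.arcsin x, ⟨Real.arcsin_pos.2 hx.1, Real.arcsin_lt_pi_div_two.2 hx.2⟩,
        Real.sin_arcsin (by linarith [hx.1]) hx.2.le⟩
  have hinj : InjOn Real.sin (Ioo 0 (Real.pi / 2)) :=
    Real.injOn_sin.mono (Ioo_subset_Icc_self.trans
      (Icc_subset_Icc (by linarith [Real.pi_pos]) le_rfl))
  have h2 := MeasureTheory.integral_image_eq_integral_abs_deriv_smul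
    (measurableSet_Ioo (a := (0 : ℝ)) (b := Real.pi / 2))
    (fun t _ => (Real.hasDerivAt_sin t).hasDerivWithinAt) hinj
    (fun θ : ℝ => 1 / √(θ ^ (-4 : ℤ) - 1))
  rw [himg] at h2
  have h3 : B = ∫ θ in Ioo (0 : ℝ) 1, 1 / √(θ ^ (-4 : ℤ) - 1) := by
    rw [B, intervalIntegral.integral_of_le zero_le_one, MeasureTheory.integral_Ioc_eq_integral_Ioo]
  rw [h1, h3, h2, abscissa, intervalIntegral.integral_of_le (by positivity),
    MeasureTheory.integral_Ioc_eq_integral_Ioo]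
  congr 1
  refine MeasureTheory.setIntegral_congr_fun measurableSet_Ioo fun t ht => ?_
  have hs : 0 < Real.sin t :=
    Real.sin_pos_of_pos_of_lt_pi ht.1 (by linarith [ht.2, Real.pi_pos])
  have hc : 0 < Real.cos t :=
    Real.cos_pos_of_mem_Ioo ⟨by linarith [ht.1, Real.pi_pos], ht.2⟩
  have h4 : Real.sin t ^ (-4 : ℤ) - 1
      = (Real.cos t / Real.sin t ^ 2) ^ 2 * (2 - 1 * Real.cos t ^ 2) := by
    have hz : Real.sin t ^ (-4 : ℤ) = (Real.sin t ^ 4)⁻¹ := by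
      rw [zpow_neg]; norm_cast
    rw [hz, Real.cos_sq']
    field_simp
    rw [Real.cos_sq']
    ring
  have h5 : 0 < √(2 - 1 * Real.cos t ^ 2) :=
    Real.sqrt_pos.2 (by linarith [mul_cos_sq_le hm t])
  simp only [density, smul_eq_mul]
  rw [h4, Real.sqrt_mul (sq_nonneg _), Real.sqrt_sq (by positivity), abs_of_pos hc]
  have h6 : 1 - 1 * Real.cos t ^ 2 = Real.sin t ^ 2 := by rw [Real.cos_sq']; ring
  rw [h6]
  field_simp

/-! ### Explicit solutions -/

/-- The slope of the solution at the angle `t`, up to the factor `√(m / κ)`. -/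
noncomputable def slopeAt (m t : ℝ) : ℝ :=
  Real.cos t * √(2 - m * Real.cos t ^ 2) / (1 - m * Real.cos t ^ 2)

/-- The explicit solution of the equation with `lam = 2 k²`, amplitude `a / k` and phase `c`;
here `κ a² = m`. -/
noncomputable def wave (a k m c x : ℝ) : ℝ := a / k * Real.sin (angle m (k * x + c))

theorem hasDerivAt_slopeAt {m : ℝ} (hm : m ∈ Icc (0 : ℝ) 1) {t : ℝ}
    (h : m < 1 ∨ Real.sin t ≠ 0) :
    HasDerivAt (slopeAt m) (-(2 * Real.sin t /
      (√(2 - m * Real.cos t ^ 2) * (1 - m * Real.cos t ^ 2) ^ 2))) t := by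
  have h1 := one_sub_mul_cos_sq_pos hm h
  have h2 : 0 < 2 - m * Real.cos t ^ 2 := by linarith
  have h3 := Real.sqrt_pos.2 h2
  have hd : ∀ b : ℝ, HasDerivAt (fun t : ℝ => b - m * Real.cos t ^ 2)
      (2 * m * Real.cos t * Real.sin t) t := fun b => by
    refine ((((Real.hasDerivAt_cos t).pow 2).const_mul m).const_sub b).congr_deriv ?_
    push_cast
    ring
  have hq := ((Real.hasDerivAt_cos t).mul ((hd 2).sqrt h2.ne')).div (hd 1) h1.ne'
  refine hq.congr_deriv ?_
  have h4 := Real.sq_sqrt h2.le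
  simp only [Pi.mul_apply]
  generalize √(2 - m * Real.cos t ^ 2) = r at *
  generalize Real.cos t = c at *
  have h5 : m * c ^ 2 = 2 - r ^ 2 := by linarith
  rw [h5] at h1 ⊢
  field_simp
  have h6 : m * c ^ 2 * Real.sin t = (2 - r ^ 2) * Real.sin t := by rw [h5]
  linear_combination -(1 + r ^ 2) * h6

theorem hasDerivAt_wave (a : ℝ) {k m : ℝ} (hk : k ≠ 0) (hm : m ∈ Icc (0 : ℝ) 1) (c : ℝ) {x : ℝ}
    (h : m < 1 ∨ Real.sin (angle m (k * x + c)) ≠ 0) :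
    HasDerivAt (wave a k m c) (a * slopeAt m (angle m (k * x + c))) x := by
  have h1 : HasDerivAt (fun x => k * x + c) k x := by
    simpa using ((hasDerivAt_id x).const_mul k).add_const c
  have h2 := (((hasDerivAt_angle hm h).comp x h1).sin).const_mul (a / k)
  refine h2.congr_deriv ?_
  simp only [density, slopeAt, Function.comp_apply, inv_div]
  field_simp

theorem one_add_slopeAt_sq {m : ℝ} (hm : m ∈ Icc (0 : ℝ) 1) {t : ℝ}
    (h : m < 1 ∨ Real.sin t ≠ 0) :
    1 + m * slopeAt m t ^ 2 = ((1 - m * Real.cos t ^ 2)⁻¹) ^ 2 := by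
  have h1 := one_sub_mul_cos_sq_pos hm h
  have h4 := Real.sq_sqrt (by linarith : 0 ≤ 2 - m * Real.cos t ^ 2)
  unfold slopeAt
  rw [div_pow, mul_pow, h4]
  field_simp
  ring

theorem sq_rpow_three_halves {x : ℝ} (hx : 0 ≤ x) : (x ^ 2) ^ (3 / 2 : ℝ) = x ^ 3 := by
  rw [← Real.rpow_natCast x 2, ← Real.rpow_mul hx, ← Real.rpow_natCast x 3]
  norm_num

/-- The first integral `1 / √(1 + κ u'²) = 1 - m cos² t` turns the equation into the derivative
formula of `slopeAt`. At `m = 1` the solution exists away from the zeros of the sine. -/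
theorem solvesAt_wave {κ a k m : ℝ} (hk : k ≠ 0) (hm : m ∈ Icc (0 : ℝ) 1)
    (ha : κ * a ^ 2 = m) (c : ℝ) {x : ℝ} (h : m < 1 ∨ Real.sin (angle m (k * x + c)) ≠ 0) :
    SolvesAt κ (2 * k ^ 2) (wave a k m c) x := by
  have h0 := hasDerivAt_wave a hk hm c h
  refine ⟨h0.differentiableAt, ?_⟩
  have hcont : Continuous fun x => Real.sin (angle m (k * x + c)) :=
    Real.continuous_sin.comp ((continuous_angle hm).comp (by fun_prop))
  have hev : ∀ᶠ y in 𝓝 x, m < 1 ∨ Real.sin (angle m (k * y + c)) ≠ 0 := by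
    rcases h with h | h
    · exact Eventually.of_forall fun _ => Or.inl h
    · exact (hcont.continuousAt.eventually_ne h).mono fun _ => Or.inr
  have hd : deriv (wave a k m c) =ᶠ[𝓝 x] fun y => a * slopeAt m (angle m (k * y + c)) :=
    hev.mono fun y hy => (hasDerivAt_wave a hk hm c hy).deriv
  refine HasDerivAt.congr_of_eventuallyEq ?_ hd
  have h1 : HasDerivAt (fun x => k * x + c) k x := by
    simpa using ((hasDerivAt_id x).const_mul k).add_const c
  have h2 := ((hasDerivAt_slopeAt hm h).comp x ((hasDerivAt_angle hm h).comp x h1)).const_mul a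
  refine h2.congr_deriv ?_
  rw [h0.deriv]
  have h3 : 1 + κ * (a * slopeAt m (angle m (k * x + c))) ^ 2
      = ((1 - m * Real.cos (angle m (k * x + c)) ^ 2)⁻¹) ^ 2 := by
    rw [← one_add_slopeAt_sq hm h, ← ha]
    ring
  have h4 := one_sub_mul_cos_sq_pos hm h
  rw [h3, sq_rpow_three_halves (by positivity)]
  simp only [density, wave, inv_div]
  have h5 := Real.sqrt_pos.2 (by linarith : 0 < 2 - m * Real.cos (angle m (k * x + c)) ^ 2)
  field_simp

theorem contDiff_wave (a : ℝ) {k m : ℝ} (hk : k ≠ 0) (hm : m ∈ Ico (0 : ℝ) 1) (c : ℝ) :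
    ContDiff ℝ 1 (wave a k m c) := by
  have hm' := Ico_subset_Icc_self hm
  have hd := fun x => hasDerivAt_wave a hk hm' c (x := x) (Or.inl hm.2)
  refine contDiff_one_iff_deriv.2 ⟨fun x => (hd x).differentiableAt, ?_⟩
  rw [funext fun x => (hd x).deriv]
  have h1 : Continuous (slopeAt m) := continuous_iff_continuousAt.2 fun t =>
    (hasDerivAt_slopeAt hm' (Or.inl hm.2)).continuousAt
  exact continuous_const.mul (h1.comp ((continuous_angle hm').comp (by fun_prop)))

/-! ### Uniqueness for the equation -/

/-- Solutions in `C¹[0,1]` that agree to first order at one interior point are equal. Since nothing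
is assumed about second derivatives at `0` and `1`, the initial point must be interior. -/
theorem eqOn_of_solvesAt {κ lam : ℝ} (hκ : 0 ≤ κ) {u v : ℝ → ℝ}
    (hu : ContDiffOn ℝ 1 u (Icc 0 1)) (hv : ContDiffOn ℝ 1 v (Icc 0 1))
    (hus : ∀ x ∈ Ioo (0 : ℝ) 1, SolvesAt κ lam u x)
    (hvs : ∀ x ∈ Ioo (0 : ℝ) 1, SolvesAt κ lam v x) {x₀ : ℝ} (hx₀ : x₀ ∈ Ioo (0 : ℝ) 1)
    (h0 : u x₀ = v x₀) (h1 : deriv u x₀ = deriv v x₀) : EqOn u v (Icc 0 1) := by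
  -- the phase curves of `u` and `v` stay in a compact ball, on which the field is Lipschitz
  have hbd : ∀ w : ℝ → ℝ, ContDiffOn ℝ 1 w (Icc 0 1) →
      ∃ R, ∀ x ∈ Ioo (0 : ℝ) 1, (w x, deriv w x) ∈ Metric.closedBall (0 : ℝ × ℝ) R := by
    intro w hw
    have hc : ContinuousOn (fun x => (w x, derivWithin w (Icc 0 1) x)) (Icc 0 1) :=
      hw.continuousOn.prodMk
        ((contDiffOn_one_iff_derivWithin (uniqueDiffOn_Icc zero_lt_one)).1 hw).2
    obtain ⟨R, hR⟩ := isCompact_Icc.exists_bound_of_continuousOn hc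
    refine ⟨R, fun x hx => ?_⟩
    rw [mem_closedBall_zero_iff, ← derivWithin_of_mem_nhds (Icc_mem_nhds hx.1 hx.2)]
    exact hR x (Ioo_subset_Icc_self hx)
  obtain ⟨R₁, hR₁⟩ := hbd u hu
  obtain ⟨R₂, hR₂⟩ := hbd v hv
  let G : ℝ × ℝ → ℝ × ℝ := fun p => (p.2, -(lam * p.1 * (1 + κ * p.2 ^ 2) ^ (3 / 2 : ℝ)))
  have hG : ContDiff ℝ 1 G := by
    refine contDiff_snd.prodMk ((contDiff_const.mul contDiff_fst).mul ?_).neg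
    exact (contDiff_const.add (contDiff_const.mul (contDiff_snd.pow 2))).rpow_const_of_ne
      fun p => by positivity
  obtain ⟨K, hK⟩ := hG.contDiffOn.exists_lipschitzOnWith one_ne_zero
    (convex_closedBall (0 : ℝ × ℝ) (max R₁ R₂)) (isCompact_closedBall _ _)
  have hsol : ∀ w : ℝ → ℝ, (∀ x ∈ Ioo (0 : ℝ) 1, SolvesAt κ lam w x) →
      ∀ x ∈ Ioo (0 : ℝ) 1, HasDerivAt (fun x => (w x, deriv w x)) (G (w x, deriv w x)) x :=
    fun w hw x hx => (hw x hx).1.hasDerivAt.prodMk (hw x hx).2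
  have key := ODE_solution_unique_of_mem_Ioo (v := fun _ => G)
    (s := fun _ => Metric.closedBall (0 : ℝ × ℝ) (max R₁ R₂)) (fun _ _ => hK) hx₀
    (fun x hx => ⟨hsol u hus x hx, Metric.closedBall_subset_closedBall (le_max_left _ _) (hR₁ x hx)⟩)
    (fun x hx => ⟨hsol v hvs x hx,
      Metric.closedBall_subset_closedBall (le_max_right _ _) (hR₂ x hx)⟩) (Prod.ext h0 h1)
  have key' : EqOn u v (Ioo 0 1) := fun x hx => congrArg Prod.fst (key hx)
  exact key'.of_subset_closure hu.continuousOn hv.continuousOn Ioo_subset_Icc_self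
    (by rw [closure_Ioo zero_ne_one])

/-- For `lam ≤ 0` the square of a solution is convex, so the Dirichlet problem has only the
trivial solution. -/
theorem eqOn_zero_of_nonpos {κ lam : ℝ} (hκ : 0 ≤ κ) (hlam : lam ≤ 0) {u : ℝ → ℝ}
    (hu : MemC10 u) (hs : ∀ x ∈ Ioo (0 : ℝ) 1, SolvesAt κ lam u x) : EqOn u 0 (Icc 0 1) := by
  obtain ⟨hc, h0, h1⟩ := hu
  have hconv : ConvexOn ℝ (Icc 0 1) (fun x => u x ^ 2) := by
    refine convexOn_of_hasDerivWithinAt2_nonneg (convex_Icc 0 1) (hc.continuousOn.pow 2)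
      (f' := fun x => 2 * (u x * deriv u x))
      (f'' := fun x => 2 * (deriv u x * deriv u x +
        u x * -(lam * u x * (1 + κ * (deriv u x) ^ 2) ^ (3 / 2 : ℝ)))) ?_ ?_ ?_
    all_goals
      intro x hx
      rw [interior_Icc] at hx
      obtain ⟨hd, hdd⟩ := hs x hx
    · refine ((hd.hasDerivAt.pow 2).congr_deriv ?_).hasDerivWithinAt
      push_cast
      ring
    · exact ((hd.hasDerivAt.mul hdd).const_mul 2).hasDerivWithinAt
    · have h2 : 0 ≤ (1 + κ * deriv u x ^ 2) ^ (3 / 2 : ℝ) := by positivity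
      have h3 : 0 ≤ -lam * (u x ^ 2 * (1 + κ * deriv u x ^ 2) ^ (3 / 2 : ℝ)) :=
        mul_nonneg (by linarith) (by positivity)
      nlinarith [sq_nonneg (deriv u x)]
  intro x hx
  have := hconv.2 (left_mem_Icc.2 zero_le_one) (right_mem_Icc.2 zero_le_one)
    (by linarith [hx.2] : 0 ≤ 1 - x) hx.1 (by ring)
  simp only [smul_eq_mul, mul_zero, mul_one, zero_add, h0, h1] at this
  exact pow_eq_zero_iff two_ne_zero |>.1 (le_antisymm (by simpa using this) (sq_nonneg _))

theorem exists_sin_eq_cos_eq {s c : ℝ} (h : s ^ 2 + c ^ 2 = 1) :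
    ∃ t, Real.sin t = s ∧ Real.cos t = c := by
  have hc : -1 ≤ c ∧ c ≤ 1 := by constructor <;> nlinarith [sq_nonneg s]
  have h1 : √(1 - c ^ 2) = |s| := by rw [← Real.sqrt_sq_eq_abs]; congr 1; linarith
  rcases le_total 0 s with hs | hs
  · exact ⟨Real.arccos c, by rw [Real.sin_arccos, h1, abs_of_nonneg hs],
      Real.cos_arccos hc.1 hc.2⟩
  · exact ⟨-Real.arccos c, by rw [Real.sin_neg, Real.sin_arccos, h1, abs_of_nonpos hs, neg_neg],
      by rw [Real.cos_neg, Real.cos_arccos hc.1 hc.2]⟩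

/-- Every pair (value, slope) whose energy lies in `(0, 1)` is attained by an explicit solution. -/
theorem exists_wave_data {κ k u₀ p₀ : ℝ} (hκ : 0 < κ) (hk : 0 < k)
    (hE : 0 < (√(1 + κ * p₀ ^ 2))⁻¹ - κ * (k * u₀) ^ 2)
    (hE' : (√(1 + κ * p₀ ^ 2))⁻¹ - κ * (k * u₀) ^ 2 < 1) :
    ∃ a m t, m ∈ Ioo (0 : ℝ) 1 ∧ κ * a ^ 2 = m ∧ a / k * Real.sin t = u₀ ∧
      a * slopeAt m t = p₀ := by
  have hw : 0 < (√(1 + κ * p₀ ^ 2))⁻¹ := by positivity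
  have hw2 : ((√(1 + κ * p₀ ^ 2))⁻¹) ^ 2 * (1 + κ * p₀ ^ 2) = 1 := by
    rw [inv_pow, Real.sq_sqrt (by positivity)]
    exact inv_mul_cancel₀ (by positivity)
  generalize (√(1 + κ * p₀ ^ 2))⁻¹ = w at *
  obtain ⟨m, hm⟩ : ∃ m, m = 1 - (w - κ * (k * u₀) ^ 2) := ⟨_, rfl⟩
  have hm0 : 0 < m := by linarith
  have ha : κ * √(m / κ) ^ 2 = m := by
    rw [Real.sq_sqrt (by positivity)]
    field_simp
  have ha0 : 0 < √(m / κ) := Real.sqrt_pos.2 (by positivity)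
  generalize √(m / κ) = a at *
  have hr : 0 < √(1 + w) := Real.sqrt_pos.2 (by linarith)
  have hr2 : √(1 + w) ^ 2 = 1 + w := Real.sq_sqrt (by linarith)
  generalize √(1 + w) = r at *
  -- with `m cos² t = 1 - w`, the formula for `slopeAt` gives `a √(1 + w) cos t / w = p₀`, which
  -- dictates the cosine; the sine is dictated by `u₀`
  have hmC : m * (p₀ * w / (a * r)) ^ 2 = 1 - w := by
    rw [← ha, div_pow, mul_pow, mul_pow, hr2]
    field_simp
    linarith
  have hmS : m * (k * u₀ / a) ^ 2 = m - (1 - w) := by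
    nth_rewrite 1 [← ha]
    rw [div_pow]
    field_simp
    linarith
  obtain ⟨t, hs, hc⟩ := exists_sin_eq_cos_eq (s := k * u₀ / a) (c := p₀ * w / (a * r))
    (mul_left_cancel₀ hm0.ne' (by rw [mul_add, hmS, hmC]; ring))
  refine ⟨a, m, t, ⟨hm0, by linarith⟩, ha, ?_, ?_⟩
  · rw [hs]
    field_simp
  · rw [slopeAt, hc, hmC]
    have h1 : 2 - (1 - w) = 1 + w := by ring
    have h2 : 1 - (1 - w) = w := by ring
    rw [h1, h2, ← hr2, Real.sqrt_sq hr.le]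
    field_simp

/-! ### Classification of the nodal solutions -/

/-- The candidate for the solution with `n` humps: the explicit solution of phase zero whose
`n`-th hump ends at `1`. For `m = 1` it is singular at the nodes. -/
noncomputable def nodalWave (κ : ℝ) (n : ℕ) (ν m : ℝ) : ℝ → ℝ :=
  wave (ν * √(m / κ)) (n * hump m) m 0

theorem nodalWave_apply (κ : ℝ) (n : ℕ) (ν m x : ℝ) : nodalWave κ n ν m x =
    ν * √(m / κ) / (n * hump m) * Real.sin (angle m (n * hump m * x)) := by
  simp [nodalWave, wave]

theorem mul_amplitude_sq {κ ν m : ℝ} (hκ : 0 < κ) (hν : ν ^ 2 = 1) (hm : 0 ≤ m) :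
    κ * (ν * √(m / κ)) ^ 2 = m := by
  rw [mul_pow, hν, Real.sq_sqrt (by positivity)]
  field_simp

theorem sin_angle_nat_mul_hump_eq_zero_iff {m : ℝ} (hm : m ∈ Icc (0 : ℝ) 1) {n : ℕ} (hn : 1 ≤ n)
    {x : ℝ} (hx : x ∈ Icc (0 : ℝ) 1) :
    Real.sin (angle m (n * hump m * x)) = 0 ↔ x ∈ nodes n := by
  have hP := hump_pos hm
  have hn' : (0 : ℝ) < n := by exact_mod_cast hn
  rw [sin_angle_eq_zero_iff hm]
  constructor
  · rintro ⟨j, hj⟩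
    have h1 : n * x = j := mul_right_cancel₀ hP.ne' (by linarith)
    have h2 : 0 ≤ j := by exact_mod_cast h1 ▸ mul_nonneg hn'.le hx.1
    lift j to ℕ using h2
    have h3 : (j : ℝ) ≤ n := by
      have : (n : ℝ) * x ≤ n := mul_le_of_le_one_right hn'.le hx.2
      rw [h1] at this
      exact_mod_cast this
    refine ⟨j, by exact_mod_cast h3, ?_⟩
    rw [eq_div_iff hn'.ne', mul_comm, h1]
    norm_cast
  · rintro ⟨j, -, rfl⟩
    refine ⟨j, ?_⟩
    push_cast
    field_simp

theorem encard_inner_nodes {n : ℕ} (hn : 1 ≤ n) :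
    {x ∈ Ioo (0 : ℝ) 1 | x ∈ nodes n}.encard = ((n - 1 : ℕ) : ℕ∞) := by
  have hn' : (0 : ℝ) < n := by exact_mod_cast hn
  have h : {x ∈ Ioo (0 : ℝ) 1 | x ∈ nodes n}
      = (fun j : ℕ => (j : ℝ) / n) '' (Finset.Ioo 0 n : Finset ℕ) := by
    ext x
    simp only [mem_ofPred_eq, mem_image, Finset.coe_Ioo]
    constructor
    · rintro ⟨hx, j, -, rfl⟩
      refine ⟨j, ⟨?_, ?_⟩, rfl⟩
      · have := (div_pos_iff_of_pos_right hn').1 hx.1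
        exact_mod_cast this
      · have := (div_lt_one hn').1 hx.2
        exact_mod_cast this
    · rintro ⟨j, hj, rfl⟩
      have h1 : (0 : ℝ) < j := by exact_mod_cast hj.1
      have h2 : (j : ℝ) < n := by exact_mod_cast hj.2
      exact ⟨⟨by positivity, (div_lt_one hn').2 h2⟩, j, hj.2.le, rfl⟩
  have hinj : Function.Injective (fun j : ℕ => (j : ℝ) / n) := fun i j hij => by
    have := (div_left_inj' hn'.ne').1 hij
    exact_mod_cast this
  rw [h, hinj.encard_image, encard_coe_eq_coe_finsetCard, Nat.card_Ioo, Nat.sub_zero]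

theorem eventually_sin_angle_pos {m k : ℝ} (hm : m ∈ Icc (0 : ℝ) 1) (hk : 0 < k) :
    ∀ᶠ x in 𝓝[>] (0 : ℝ), 0 < Real.sin (angle m (k * x)) := by
  have h1 : Tendsto (fun x => angle m (k * x)) (𝓝 0) (𝓝 0) := by
    have : Continuous fun x => angle m (k * x) := (continuous_angle hm).comp (by fun_prop)
    simpa [angle_zero hm] using this.tendsto 0
  filter_upwards [nhdsWithin_le_nhds (h1.eventually (gt_mem_nhds Real.pi_pos)),
    self_mem_nhdsWithin] with x hx hx0
  have h2 := strictMono_angle hm (mul_pos hk hx0)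
  rw [angle_zero hm] at h2
  exact Real.sin_pos_of_pos_of_lt_pi h2 hx

theorem isNodalSolution_nodalWave {κ : ℝ} (hκ : 0 < κ) {n : ℕ} (hn : 1 ≤ n) {ν : ℝ}
    (hν : ν ^ 2 = 1) {m : ℝ} (hm : m ∈ Ioo (0 : ℝ) 1) :
    IsNodalSolution κ (2 * (n * hump m) ^ 2) n ν (nodalWave κ n ν m) := by
  have hm' := Ioo_subset_Icc_self hm
  have hP := hump_pos hm'
  have hn' : (0 : ℝ) < n := by exact_mod_cast hn
  have hk : 0 < n * hump m := by positivity
  have hm0 := hm.1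
  have ha : 0 < √(m / κ) := Real.sqrt_pos.2 (by positivity)
  have hν0 : ν ≠ 0 := fun h => by simp [h] at hν
  have hzero : ∀ x, nodalWave κ n ν m x = 0 ↔ Real.sin (angle m (n * hump m * x)) = 0 := fun x => by
    rw [nodalWave_apply, mul_eq_zero, or_iff_right]
    positivity
  have hend : ∀ x ∈ Icc (0 : ℝ) 1, x ∈ nodes n → nodalWave κ n ν m x = 0 := fun x hx h =>
    (hzero x).2 ((sin_angle_nat_mul_hump_eq_zero_iff hm' hn hx).2 h)
  refine ⟨⟨⟨(contDiff_wave _ hk.ne' (Ioo_subset_Ico_self hm) 0).contDiffOn,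
    hend 0 (by simp) ⟨0, by simp⟩, hend 1 (by simp) ⟨n, le_rfl, by field_simp⟩⟩, ?_, ?_, ?_⟩,
    fun x _ => solvesAt_wave hk.ne' hm' (mul_amplitude_sq hκ hν hm.1.le) 0 (Or.inl hm.2)⟩
  · rw [← encard_inner_nodes hn]
    congr 1
    ext x
    refine and_congr_right fun hx => ?_
    rw [hzero, sin_angle_nat_mul_hump_eq_zero_iff hm' hn (Ioo_subset_Icc_self hx)]
  · intro x _ hx
    rw [hzero] at hx
    have hd : deriv (nodalWave κ n ν m) x = _ :=
      (hasDerivAt_wave (ν * √(m / κ)) hk.ne' hm' 0 (Or.inl hm.2)).deriv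
    have hc : Real.cos (angle m (n * hump m * x)) ≠ 0 := fun h => by
      have := Real.sin_sq_add_cos_sq (angle m (n * hump m * x))
      simp [hx, h] at this
    have h1 := one_sub_mul_cos_sq_pos hm' (t := angle m (n * hump m * x)) (Or.inl hm.2)
    have h2 := Real.sqrt_pos.2
      (by linarith : 0 < 2 - m * Real.cos (angle m (n * hump m * x)) ^ 2)
    rw [hd, slopeAt, add_zero]
    positivity
  · filter_upwards [eventually_sin_angle_pos hm' hk] with x hx
    have : ν * nodalWave κ n ν m x =
        ν ^ 2 * (√(m / κ) / (n * hump m) * Real.sin (angle m (n * hump m * x))) := by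
      rw [nodalWave_apply]
      ring
    rw [this, hν]
    positivity

/-- Every nodal solution is one of the explicit ones: near `0` its energy lies in `(0, 1)`, so it is
a shifted wave, and the boundary values, the sign and the number of zeros fix the phase, the
amplitude and `k`. -/
theorem IsNodalSolution.exists_nodalWave {κ : ℝ} (hκ : 0 < κ) {n : ℕ} (hn : 1 ≤ n) {ν : ℝ}
    (hν : ν ^ 2 = 1) {lam : ℝ} {u : ℝ → ℝ} (h : IsNodalSolution κ lam n ν u) :
    ∃ m ∈ Ioo (0 : ℝ) 1, lam = 2 * (n * hump m) ^ 2 ∧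
      EqOn u (nodalWave κ n ν m) (Icc 0 1) := by
  obtain ⟨⟨hu, hcard, -, hpos⟩, hsol⟩ := h
  have hIoo : Ioo (0 : ℝ) 1 ∈ 𝓝[>] (0 : ℝ) := Ioo_mem_nhdsGT zero_lt_one
  have hlam : 0 < lam := by
    by_contra! hlam
    obtain ⟨x, hx, hx'⟩ := (hpos.and (eventually_of_mem hIoo fun x hx => hx)).exists
    simp [eqOn_zero_of_nonpos hκ.le hlam hu hsol (Ioo_subset_Icc_self hx')] at hx
  obtain ⟨hC1, hu0, hu1⟩ := hu
  obtain ⟨k, hk, hlamk⟩ : ∃ k, 0 < k ∧ lam = 2 * k ^ 2 :=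
    ⟨√(lam / 2), Real.sqrt_pos.2 (by positivity), by rw [Real.sq_sqrt (by positivity)]; ring⟩
  subst hlamk
  -- a point close to `0`, where the energy lies in `(0, 1)`
  obtain ⟨x₀, hx₀, hu₀, hE⟩ : ∃ x₀ ∈ Ioo (0 : ℝ) 1, u x₀ ≠ 0 ∧
      0 < (√(1 + κ * deriv u x₀ ^ 2))⁻¹ - κ * (k * u x₀) ^ 2 := by
    have hc : ContinuousOn (fun x => (√(1 + κ * derivWithin u (Icc 0 1) x ^ 2))⁻¹ -
        κ * (k * u x) ^ 2) (Icc 0 1) := by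
      have h1 := ((contDiffOn_one_iff_derivWithin (uniqueDiffOn_Icc zero_lt_one)).1 hC1).2
      have h2 := hC1.continuousOn
      refine ContinuousOn.sub (ContinuousOn.inv₀ (by fun_prop) fun x _ => ?_) (by fun_prop)
      exact (Real.sqrt_pos.2 (by positivity)).ne'
    have h0 : 0 < (√(1 + κ * derivWithin u (Icc 0 1) 0 ^ 2))⁻¹ - κ * (k * u 0) ^ 2 := by
      rw [hu0]
      simp only [mul_zero, ne_eq, OfNat.ofNat_ne_zero, not_false_eq_true, zero_pow, sub_zero]
      positivity
    have hev := (hc 0 (by simp)).eventually (lt_mem_nhds h0)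
    obtain ⟨x, ⟨hx1, hx2⟩, hx3⟩ := ((hpos.and (nhdsWithin_le_iff.2
      (mem_of_superset hIoo Ioo_subset_Icc_self) hev)).and
        (eventually_of_mem hIoo fun x hx => hx)).exists
    rw [derivWithin_of_mem_nhds (Icc_mem_nhds hx3.1 hx3.2)] at hx2
    exact ⟨x, hx3, fun h => by simp [h] at hx1, hx2⟩
  have hE' : (√(1 + κ * deriv u x₀ ^ 2))⁻¹ - κ * (k * u x₀) ^ 2 < 1 := by
    have h1 : (√(1 + κ * deriv u x₀ ^ 2))⁻¹ ≤ 1 :=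
      inv_le_one_of_one_le₀ (Real.one_le_sqrt.2 (by nlinarith [sq_nonneg (deriv u x₀)]))
    have h2 : 0 < κ * (k * u x₀) ^ 2 := by positivity
    linarith
  -- the explicit solution through the same point of the phase plane
  obtain ⟨a, m, t, hm, ha, hat, hat'⟩ := exists_wave_data hκ hk hE hE'
  have hm' := Ioo_subset_Icc_self hm
  have hP := hump_pos hm'
  obtain ⟨c, hc⟩ : ∃ c, abscissa m t = k * x₀ + c := ⟨abscissa m t - k * x₀, by ring⟩
  have hct : angle m (k * x₀ + c) = t := angle_eq hm' hc
  have huw : EqOn u (wave a k m c) (Icc 0 1) := by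
    refine eqOn_of_solvesAt hκ.le hC1
      (contDiff_wave a hk.ne' (Ioo_subset_Ico_self hm) c).contDiffOn hsol
      (fun x _ => solvesAt_wave hk.ne' hm' ha c (Or.inl hm.2)) hx₀ ?_ ?_
    · rw [wave, hct, hat]
    · rw [(hasDerivAt_wave a hk.ne' hm' c (Or.inl hm.2)).deriv, hct, hat']
  have ha0 : a ≠ 0 := by
    rintro rfl
    simp at ha
    exact hm.1.ne ha
  -- the boundary condition at `0` makes the phase a multiple of the hump
  obtain ⟨j, rfl⟩ : ∃ j : ℤ, c = j * hump m := by
    rw [← sin_angle_eq_zero_iff hm']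
    have := huw (left_mem_Icc.2 zero_le_one)
    rw [hu0, wave, mul_zero, zero_add] at this
    exact (mul_eq_zero.1 this.symm).resolve_left (by positivity)
  have huw' : ∀ x ∈ Icc (0 : ℝ) 1,
      u x = a * (-1) ^ j / k * Real.sin (angle m (k * x)) := fun x hx => by
    rw [huw hx, wave, angle_add_int_mul_hump hm', Real.sin_add_int_mul_pi]
    ring
  have hj : ((-1 : ℝ) ^ j) ^ 2 = 1 := by
    rw [← zpow_natCast, ← zpow_mul, mul_comm, zpow_mul]
    norm_num
  obtain ⟨b, hb⟩ : ∃ b, b = a * (-1 : ℝ) ^ j := ⟨_, rfl⟩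
  rw [← hb] at huw'
  have hbm : κ * b ^ 2 = m := by rw [hb, mul_pow, hj, mul_one, ha]
  have hb0 : b ≠ 0 := by
    rintro rfl
    simp at hbm
    exact hm.1.ne hbm
  -- the sign near `0` determines the sign of the amplitude
  have hνb : 0 < ν * b := by
    obtain ⟨x, ⟨hx1, hx2⟩, hx3⟩ := ((hpos.and (eventually_sin_angle_pos hm' hk)).and
      (eventually_of_mem hIoo fun x hx => hx)).exists
    rw [huw' x (Ioo_subset_Icc_self hx3)] at hx1
    have : ν * (b / k * Real.sin (angle m (k * x)))
        = ν * b * (Real.sin (angle m (k * x)) / k) := by ring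
    rw [this] at hx1
    exact pos_of_mul_pos_left hx1 (by positivity)
  have hbν : b = ν * √(m / κ) := by
    have h1 : ν * b = √(m / κ) := by
      rw [← Real.sqrt_sq hνb.le, mul_pow, hν, one_mul, ← hbm]
      congr 1
      field_simp
    rw [← h1, ← mul_assoc, ← sq, hν, one_mul]
  -- the boundary condition at `1` makes `k` a multiple of the hump
  obtain ⟨N, hN, rfl⟩ : ∃ N : ℕ, 1 ≤ N ∧ k = N * hump m := by
    have h1 := huw' 1 (right_mem_Icc.2 zero_le_one)
    rw [hu1, mul_one] at h1
    obtain ⟨i, hi⟩ := (sin_angle_eq_zero_iff hm').1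
      ((mul_eq_zero.1 h1.symm).resolve_left (by positivity))
    have h2 : (0 : ℝ) < i := pos_of_mul_pos_left (hi ▸ hk) hP.le
    have h3 : 0 < i := by exact_mod_cast h2
    lift i to ℕ using h3.le
    exact ⟨i, by exact_mod_cast h3, by exact_mod_cast hi⟩
  -- the number of zeros determines the multiple
  obtain rfl : N = n := by
    have h1 : {x ∈ Ioo (0 : ℝ) 1 | u x = 0} = {x ∈ Ioo (0 : ℝ) 1 | x ∈ nodes N} := by
      ext x
      refine and_congr_right fun hx => ?_
      rw [huw' x (Ioo_subset_Icc_self hx),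
        ← sin_angle_nat_mul_hump_eq_zero_iff hm' hN (Ioo_subset_Icc_self hx), mul_eq_zero,
        or_iff_right (by positivity)]
    rw [h1, encard_inner_nodes hN] at hcard
    have : N - 1 = n - 1 := by exact_mod_cast hcard
    omega
  refine ⟨m, hm, rfl, fun x hx => ?_⟩
  rw [huw' x hx, nodalWave_apply, hbν]

/-! ### Shape of the nodal solutions -/

theorem nodalWave_add (κ : ℝ) {n : ℕ} (hn : 1 ≤ n) (ν : ℝ) {m : ℝ} (hm : m ∈ Icc (0 : ℝ) 1)
    (j : ℕ) (x : ℝ) :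
    nodalWave κ n ν m (j / n + x) = (-1) ^ j * nodalWave κ n ν m x := by
  have hn' : (0 : ℝ) < n := by exact_mod_cast hn
  have h1 : n * hump m * (j / n + x) = n * hump m * x + ((j : ℤ) : ℝ) * hump m := by
    push_cast
    field_simp
    ring
  rw [nodalWave_apply, nodalWave_apply, h1, angle_add_int_mul_hump hm, Real.sin_add_int_mul_pi,
    zpow_natCast]
  ring

theorem nodalWave_sub (κ : ℝ) {n : ℕ} (hn : 1 ≤ n) (ν : ℝ) {m : ℝ} (hm : m ∈ Icc (0 : ℝ) 1)
    (x : ℝ) : nodalWave κ n ν m (1 / n - x) = nodalWave κ n ν m x := by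
  have hn' : (0 : ℝ) < n := by exact_mod_cast hn
  have h1 : n * hump m * (1 / n - x) = hump m - n * hump m * x := by field_simp
  rw [nodalWave_apply, nodalWave_apply, h1, angle_hump_sub hm, Real.sin_pi_sub]

theorem nodes_subset {n : ℕ} (hn : 1 ≤ n) : nodes n ⊆ Icc 0 1 := by
  have hn' : (0 : ℝ) < n := by exact_mod_cast hn
  rintro _ ⟨j, hj, rfl⟩
  exact ⟨by positivity, (div_le_one hn').2 (by exact_mod_cast hj)⟩

theorem nodalWave_eq_zero_iff {κ : ℝ} (hκ : 0 < κ) {n : ℕ} (hn : 1 ≤ n) {ν : ℝ} (hν : ν ^ 2 = 1)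
    {m : ℝ} (hm : m ∈ Ioc (0 : ℝ) 1) {x : ℝ} (hx : x ∈ Icc (0 : ℝ) 1) :
    nodalWave κ n ν m x = 0 ↔ x ∈ nodes n := by
  have hm' := Ioc_subset_Icc_self hm
  have hn' : (0 : ℝ) < n := by exact_mod_cast hn
  have hP := hump_pos hm'
  have hm0 := hm.1
  have ha : 0 < √(m / κ) := Real.sqrt_pos.2 (by positivity)
  have hν0 : ν ≠ 0 := fun h => by simp [h] at hν
  rw [nodalWave_apply, mul_eq_zero, or_iff_right (by positivity),
    sin_angle_nat_mul_hump_eq_zero_iff hm' hn hx]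

theorem nodalWave_half (κ : ℝ) {n : ℕ} (hn : 1 ≤ n) (ν : ℝ) {m : ℝ} (hm : m ∈ Icc (0 : ℝ) 1) :
    nodalWave κ n ν m (1 / (2 * n)) = ν * (√(m / κ) / (n * hump m)) := by
  have hn' : (0 : ℝ) < n := by exact_mod_cast hn
  have h1 : n * hump m * (1 / (2 * n)) = hump m / 2 := by field_simp
  rw [nodalWave_apply, h1, angle_half_hump hm, Real.sin_pi_div_two]
  ring

theorem supNorm_eq {κ : ℝ} {n : ℕ} (hn : 1 ≤ n) {ν : ℝ} (hν : ν ^ 2 = 1)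
    {m : ℝ} (hm : m ∈ Icc (0 : ℝ) 1) {u : ℝ → ℝ} (hu : EqOn u (nodalWave κ n ν m) (Icc 0 1)) :
    supNorm u = √(m / κ) / (n * hump m) := by
  have hn' : (1 : ℝ) ≤ n := by exact_mod_cast hn
  have hP := hump_pos hm
  have hν1 : |ν| = 1 := by rw [← Real.sqrt_sq_eq_abs, hν, Real.sqrt_one]
  have hA : 0 ≤ √(m / κ) / (n * hump m) := by positivity
  refine IsGreatest.csSup_eq ⟨⟨1 / (2 * n), ⟨by positivity, ?_⟩, ?_⟩, ?_⟩
  · rw [div_le_one (by positivity)]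
    linarith
  · simp only
    rw [hu ⟨by positivity, by rw [div_le_one (by positivity)]; linarith⟩, nodalWave_half κ hn ν hm,
      abs_mul, hν1, one_mul, abs_of_nonneg hA]
  · rintro _ ⟨x, hx, rfl⟩
    simp only
    rw [hu hx, nodalWave_apply, mul_div_assoc, abs_mul, abs_mul, hν1, one_mul, abs_of_nonneg hA]
    exact mul_le_of_le_one_right hA (Real.abs_sin_le_one _)

theorem mul_derivWithin_eq {κ : ℝ} {n : ℕ} (hn : 1 ≤ n) {ν : ℝ} (hν : ν ^ 2 = 1)
    {m : ℝ} (hm : m ∈ Ico (0 : ℝ) 1) {u : ℝ → ℝ} (hu : EqOn u (nodalWave κ n ν m) (Icc 0 1)) :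
    ν * derivWithin u (Icc 0 1) 0 = √(m / κ) * (√(2 - m) / (1 - m)) := by
  have hm' := Ico_subset_Icc_self hm
  have hn' : (0 : ℝ) < n := by exact_mod_cast hn
  have hP := hump_pos hm'
  have h0 : (0 : ℝ) ∈ Icc (0 : ℝ) 1 := by simp
  have h1 := hasDerivAt_wave (ν * √(m / κ)) (by positivity : n * hump m ≠ 0) hm' 0
    (x := 0) (Or.inl hm.2)
  rw [derivWithin_congr hu (hu h0), nodalWave,
    (h1.hasDerivWithinAt (s := Icc 0 1)).derivWithin (uniqueDiffOn_Icc zero_lt_one 0 h0)]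
  simp only [mul_zero, add_zero, angle_zero hm', slopeAt, Real.cos_zero, one_pow, mul_one, one_mul]
  rw [← mul_assoc, ← mul_assoc, ← sq, hν, one_mul]

/-! ### Dependence on the parameter -/

theorem eight_mul_B (n : ℕ) : 8 * (n : ℝ) ^ 2 * B ^ 2 = 2 * (n * hump 1) ^ 2 := by
  rw [hump_one]
  ring

theorem mul_pi_sq (n : ℕ) : (n : ℝ) ^ 2 * Real.pi ^ 2 = 2 * (n * hump 0) ^ 2 := by
  rw [hump_zero, mul_pow, div_pow, Real.sq_sqrt zero_le_two]
  ring

/-- The solution with parameter `m` has `n * hump m = √(lam / 2)`, so this says that `lam` is a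
strictly decreasing function of `m`. -/
theorem strictAntiOn_two_mul_hump_sq {n : ℕ} (hn : 1 ≤ n) :
    StrictAntiOn (fun m => 2 * (n * hump m) ^ 2) (Icc 0 1) := fun a ha b hb hab => by
  have hn' : (0 : ℝ) < n := by exact_mod_cast hn
  have h1 := strictAntiOn_hump ha hb hab
  have h2 := hump_pos hb
  simp only
  gcongr

theorem exists_two_mul_hump_sq_eq {n : ℕ} {lam : ℝ}
    (h : lam ∈ Ioo (8 * (n : ℝ) ^ 2 * B ^ 2) ((n : ℝ) ^ 2 * Real.pi ^ 2)) :
    ∃ m ∈ Ioo (0 : ℝ) 1, 2 * (n * hump m) ^ 2 = lam := by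
  rw [eight_mul_B, mul_pi_sq] at h
  exact intermediate_value_Ioo' zero_le_one
    ((continuousOn_const.mul ((continuousOn_const.mul continuousOn_hump).pow 2)) :
      ContinuousOn (fun m => 2 * (n * hump m) ^ 2) (Icc 0 1)) h

/-- The parameter depends continuously on `lam`, up to the end values `m = 0` and `m = 1`. -/
theorem tendsto_parameter {n : ℕ} (hn : 1 ≤ n) {ι : Type*} {l : Filter ι} {μ : ι → ℝ} {m : ℝ}
    (hμ : ∀ᶠ i in l, μ i ∈ Icc (0 : ℝ) 1) (hm : m ∈ Icc (0 : ℝ) 1)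
    (h : Tendsto (fun i => 2 * (n * hump (μ i)) ^ 2) l (𝓝 (2 * (n * hump m) ^ 2))) :
    Tendsto μ l (𝓝 m) :=
  tendsto_of_tendsto_comp (f := fun m => 2 * (n * hump m) ^ 2) isCompact_Icc
    (continuousOn_const.mul ((continuousOn_const.mul continuousOn_hump).pow 2))
    (strictAntiOn_two_mul_hump_sq hn).injOn hm hμ h

/-- Joint continuity of the angle, including the singular value `m = 1`, where `angle m` is
not differentiable: `(m, t) ↦ (m, abscissa m t)` is injective and continuous on a compact set. -/
theorem tendsto_angle (n : ℕ) {ι : Type*} {l : Filter ι} {μ : ι → ℝ} {m : ℝ}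
    (hμ : ∀ᶠ i in l, μ i ∈ Icc (0 : ℝ) 1) (hm : m ∈ Icc (0 : ℝ) 1) (h : Tendsto μ l (𝓝 m))
    {x : ℝ} (hx : x ∈ Icc (0 : ℝ) 1) :
    Tendsto (fun i => angle (μ i) (n * hump (μ i) * x)) l (𝓝 (angle m (n * hump m * x))) := by
  -- all angles lie in the compact interval `[0, n π]`
  have hmem : ∀ m ∈ Icc (0 : ℝ) 1, angle m (n * hump m * x) ∈ Icc 0 (n * Real.pi) := by
    intro m hm
    have hP := hump_pos hm
    have hmono := (strictMono_angle hm).monotone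
    constructor
    · rw [← angle_zero hm]
      exact hmono (mul_nonneg (by positivity) hx.1)
    · have := angle_int_mul_hump hm n
      push_cast at this
      rw [← this]
      exact hmono (mul_le_of_le_one_right (by positivity) hx.2)
  have hhump : Tendsto (fun i => hump (μ i)) l (𝓝 (hump m)) :=
    (continuousOn_hump m hm).tendsto.comp (tendsto_nhdsWithin_iff.2 ⟨h, hμ⟩)
  have key : Tendsto (fun i => (μ i, angle (μ i) (n * hump (μ i) * x))) l
      (𝓝 (m, angle m (n * hump m * x))) := by
    refine tendsto_of_tendsto_comp (f := fun p : ℝ × ℝ => (p.1, abscissa p.1 p.2))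
      (isCompact_Icc.prod isCompact_Icc)
      (continuousOn_fst.prodMk (continuousOn_abscissa.mono (prod_mono_right (subset_univ _))))
      ?_ ⟨hm, hmem m hm⟩ (hμ.mono fun i hi => ⟨hi, hmem _ hi⟩) ?_
    · rintro ⟨m₁, t₁⟩ ⟨h₁, -⟩ ⟨m₂, t₂⟩ - h
      obtain ⟨h12, h'⟩ := Prod.mk.inj h
      simp only at h12 h' h₁
      subst h12
      rw [(strictMono_abscissa h₁).injective h']
    · simp only [abscissa_angle hm]
      have h1 := h.prodMk_nhds ((tendsto_const_nhds (x := (n : ℝ)).mul hhump).mul_const x)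
      refine h1.congr' (hμ.mono fun i hi => ?_)
      simp only [abscissa_angle hi]
  exact (continuous_snd.tendsto _).comp key

theorem continuousOn_amplitude (κ : ℝ) {n : ℕ} (hn : 1 ≤ n) :
    ContinuousOn (fun m => √(m / κ) / (n * hump m)) (Icc 0 1) := by
  have hn' : (0 : ℝ) < n := by exact_mod_cast hn
  refine ContinuousOn.div (by fun_prop) (continuousOn_const.mul continuousOn_hump) fun m hm => ?_
  have := hump_pos hm
  positivity

theorem tendsto_nodalWave (κ : ℝ) {n : ℕ} (hn : 1 ≤ n) (ν : ℝ) {ι : Type*} {l : Filter ι}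
    {μ : ι → ℝ} {m : ℝ} (hμ : ∀ᶠ i in l, μ i ∈ Icc (0 : ℝ) 1) (hm : m ∈ Icc (0 : ℝ) 1)
    (h : Tendsto μ l (𝓝 m)) {x : ℝ} (hx : x ∈ Icc (0 : ℝ) 1) :
    Tendsto (fun i => nodalWave κ n ν (μ i) x) l (𝓝 (nodalWave κ n ν m x)) := by
  have h1 : Tendsto (fun i => √(μ i / κ) / (n * hump (μ i))) l (𝓝 (√(m / κ) / (n * hump m))) :=
    (continuousOn_amplitude κ hn m hm).tendsto.comp (tendsto_nhdsWithin_iff.2 ⟨h, hμ⟩)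
  have h2 := (Real.continuous_sin.tendsto _).comp (tendsto_angle n hμ hm h hx)
  simpa only [nodalWave_apply, mul_div_assoc, Function.comp_apply] using (h1.const_mul ν).mul h2

theorem strictMonoOn_amplitude {κ : ℝ} (hκ : 0 < κ) {n : ℕ} (hn : 1 ≤ n) :
    StrictMonoOn (fun m => √(m / κ) / (n * hump m)) (Icc 0 1) := fun a ha b hb hab => by
  have hn' : (0 : ℝ) < n := by exact_mod_cast hn
  have h1 := strictAntiOn_hump ha hb hab
  have h2 := hump_pos hb
  have h3 : √(a / κ) < √(b / κ) :=
    Real.sqrt_lt_sqrt (div_nonneg ha.1 hκ.le) (by gcongr)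
  exact div_lt_div₀ h3 (by gcongr) (Real.sqrt_nonneg _) (by positivity)

/-- The initial slope squared is `((1 - m)⁻² - 1) / κ`, which increases with `m`. -/
theorem strictMonoOn_initialSlope {κ : ℝ} (hκ : 0 < κ) :
    StrictMonoOn (fun m => √(m / κ) * (√(2 - m) / (1 - m))) (Ico 0 1) := fun a ha b hb hab => by
  have ha1 : 0 < 1 - a := by linarith [ha.2]
  have hb1 : 0 < 1 - b := by linarith [hb.2]
  have hs : ∀ m : ℝ, 0 ≤ m → 0 < 1 - m → √(m / κ) * (√(2 - m) / (1 - m))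
      = √(((1 - m)⁻¹ ^ 2 - 1) / κ) := fun m h0 h => by
    have h1 : ((1 - m)⁻¹ ^ 2 - 1) / κ = m / κ * ((2 - m) / (1 - m) ^ 2) := by
      field_simp
      ring
    rw [h1, Real.sqrt_mul (div_nonneg h0 hκ.le), Real.sqrt_div (by linarith : 0 ≤ 2 - m),
      Real.sqrt_sq h.le]
  simp only
  rw [hs a ha.1 ha1, hs b (ha.1.trans hab.le) hb1]
  have h2 : 1 ≤ (1 - a)⁻¹ := (one_le_inv₀ ha1).2 (by linarith [ha.1])
  refine Real.sqrt_lt_sqrt (div_nonneg (by nlinarith) hκ.le) ?_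
  have h3 : (1 - a)⁻¹ < (1 - b)⁻¹ := (inv_lt_inv₀ ha1 hb1).2 (by linarith)
  gcongr

theorem tendsto_initialSlope {κ : ℝ} (hκ : 0 < κ) {ι : Type*} {l : Filter ι} {μ : ι → ℝ}
    (hμ : ∀ᶠ i in l, μ i < 1) (h : Tendsto μ l (𝓝 1)) :
    Tendsto (fun i => √(μ i / κ) * (√(2 - μ i) / (1 - μ i))) l atTop := by
  have h1 : Tendsto (fun i => √(μ i / κ) * √(2 - μ i)) l (𝓝 (√(1 / κ) * √(2 - 1))) :=
    (h.div_const κ).sqrt.mul (h.const_sub 2).sqrt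
  have h2 : Tendsto (fun i => 1 - μ i) l (𝓝[>] 0) :=
    tendsto_nhdsWithin_iff.2 ⟨by simpa using h.const_sub 1, hμ.mono fun i hi => sub_pos.2 hi⟩
  have h3 : 0 < √(1 / κ) * √(2 - 1) := by norm_num; positivity
  refine (h1.pos_mul_atTop h3 h2.inv_tendsto_nhdsGT_zero).congr fun i => ?_
  simp only [Pi.inv_apply]
  ring

theorem differentiableAt_parameter {n : ℕ} (hn : 1 ≤ n) {μ : ℝ → ℝ} {s : Set ℝ} (hs : IsOpen s)
    (hμ : ∀ lam ∈ s, μ lam ∈ Ioo (0 : ℝ) 1 ∧ 2 * (n * hump (μ lam)) ^ 2 = lam) {lam : ℝ}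
    (hlam : lam ∈ s) : DifferentiableAt ℝ μ lam := by
  have hn' : (0 : ℝ) < n := by exact_mod_cast hn
  have hev : ∀ᶠ x in 𝓝 lam, x ∈ s := hs.mem_nhds hlam
  have hm' := Ioo_subset_Icc_self (hμ lam hlam).1
  have hP := hump_pos hm'
  obtain ⟨d, hd, h⟩ := exists_hasDerivAt_hump (hμ lam hlam).1
  have hcont : ContinuousAt μ lam := by
    refine tendsto_parameter hn (hev.mono fun x hx => Ioo_subset_Icc_self (hμ x hx).1) hm' ?_
    rw [(hμ lam hlam).2]
    exact tendsto_id.congr' (hev.mono fun x hx => (hμ x hx).2.symm)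
  have h2 : HasDerivAt (fun m => 2 * (n * hump m) ^ 2) (4 * n ^ 2 * hump (μ lam) * d) (μ lam) := by
    refine (((h.const_mul (n : ℝ)).pow 2).const_mul 2).congr_deriv ?_
    push_cast
    ring
  exact (h2.of_local_left_inverse hcont (mul_ne_zero (by positivity) hd.ne)
    (hev.mono fun x hx => (hμ x hx).2)).differentiableAt

theorem differentiableAt_amplitude {κ : ℝ} (hκ : 0 < κ) {n : ℕ} (hn : 1 ≤ n) {m : ℝ}
    (hm : m ∈ Ioo (0 : ℝ) 1) : DifferentiableAt ℝ (fun m => √(m / κ) / (n * hump m)) m := by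
  have hn' : (0 : ℝ) < n := by exact_mod_cast hn
  have hP := hump_pos (Ioo_subset_Icc_self hm)
  have hm0 := hm.1
  obtain ⟨d, -, h⟩ := exists_hasDerivAt_hump hm
  exact ((differentiableAt_id.div_const κ).sqrt (by simp; constructor <;> positivity)).div
    (h.differentiableAt.const_mul _) (by positivity)

/-! ### The singular limit -/

/-- If the derivative tends to `+∞` at a point, so do the difference quotients. -/
theorem tendsto_slope_atTop {f : ℝ → ℝ} (hf : ContinuousOn f (Icc 0 1)) {a : ℝ}
    (ha : a ∈ Icc (0 : ℝ) 1)
    (hd : ∀ᶠ x in 𝓝[Ioo 0 1 \ {a}] a, DifferentiableAt ℝ f x)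
    (h : Tendsto (deriv f) (𝓝[Ioo 0 1 \ {a}] a) atTop) :
    Tendsto (slope f a) (𝓝[Icc 0 1 \ {a}] a) atTop := by
  -- each difference quotient is a derivative at a point between, by the mean value theorem
  have mvt : ∀ x y : ℝ, x < y → x ∈ Icc (0 : ℝ) 1 → y ∈ Icc (0 : ℝ) 1 →
      (∀ z ∈ Ioo x y, DifferentiableAt ℝ f z) → ∃ z ∈ Ioo x y, deriv f z = slope f x y := by
    intro x y hxy hx hy hz
    obtain ⟨z, hz, he⟩ := exists_deriv_eq_slope f hxy (hf.mono (Icc_subset_Icc hx.1 hy.2))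
      fun z hz' => (hz z hz').differentiableWithinAt
    exact ⟨z, hz, by rw [he, slope_def_field]⟩
  rw [tendsto_atTop]
  intro C
  obtain ⟨ε, hε, hball⟩ := Metric.mem_nhdsWithin_iff.1 (hd.and (h.eventually_ge_atTop C))
  refine Metric.mem_nhdsWithin_iff.2 ⟨ε, hε, ?_⟩
  rintro x ⟨hxε, hx, hxa⟩
  rw [Metric.mem_ball, Real.dist_eq, abs_lt] at hxε
  rcases lt_or_gt_of_ne hxa with hlt | hlt
  · have hsub : ∀ z ∈ Ioo x a, DifferentiableAt ℝ f z ∧ C ≤ deriv f z := fun z hz =>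
      hball ⟨by rw [Metric.mem_ball, Real.dist_eq, abs_lt]; constructor <;> linarith [hz.1, hz.2],
        ⟨hx.1.trans_lt hz.1, hz.2.trans_le ha.2⟩, hz.2.ne⟩
    obtain ⟨z, hz, he⟩ := mvt x a hlt hx ha fun z hz => (hsub z hz).1
    change C ≤ slope f a x
    rw [slope_comm, ← he]
    exact (hsub z hz).2
  · have hsub : ∀ z ∈ Ioo a x, DifferentiableAt ℝ f z ∧ C ≤ deriv f z := fun z hz =>
      hball ⟨by rw [Metric.mem_ball, Real.dist_eq, abs_lt]; constructor <;> linarith [hz.1, hz.2],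
        ⟨ha.1.trans_lt hz.1, hz.2.trans_le hx.2⟩, hz.1.ne'⟩
    obtain ⟨z, hz, he⟩ := mvt a x hlt ha hx fun z hz => (hsub z hz).1
    change C ≤ slope f a x
    rw [← he]
    exact (hsub z hz).2

theorem continuous_nodalWave (κ : ℝ) (n : ℕ) (ν : ℝ) {m : ℝ} (hm : m ∈ Icc (0 : ℝ) 1) :
    Continuous (nodalWave κ n ν m) :=
  continuous_const.mul (Real.continuous_sin.comp ((continuous_angle hm).comp (by fun_prop)))

theorem eventually_sin_ne_zero (j : ℕ) : ∀ᶠ t in 𝓝[≠] (j * Real.pi), Real.sin t ≠ 0 :=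
  (Real.hasDerivAt_sin _).eventually_ne (by
    rw [Real.cos_nat_mul_pi]
    exact pow_ne_zero _ (by norm_num))

theorem tendsto_slopeAt_one (j : ℕ) :
    Tendsto (fun t => (-1) ^ j * slopeAt 1 t) (𝓝[≠] (j * Real.pi)) atTop := by
  have h1 : Tendsto (fun t => (-1) ^ j * (Real.cos t * √(2 - 1 * Real.cos t ^ 2)))
      (𝓝[≠] (j * Real.pi)) (𝓝 1) := by
    have hc : Continuous fun t => (-1) ^ j * (Real.cos t * √(2 - 1 * Real.cos t ^ 2)) := by
      fun_prop
    have := hc.tendsto (j * Real.pi)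
    have h2 : ((-1 : ℝ) ^ j) ^ 2 = 1 := by rw [← pow_mul, mul_comm, pow_mul]; norm_num
    have h3 : (2 : ℝ) - 1 = 1 := by norm_num
    rw [Real.cos_nat_mul_pi, h2, one_mul, h3, Real.sqrt_one, mul_one, ← sq, h2] at this
    exact this.mono_left nhdsWithin_le_nhds
  have h2 : Tendsto (fun t => 1 - 1 * Real.cos t ^ 2) (𝓝[≠] (j * Real.pi)) (𝓝[>] 0) := by
    have hs : ∀ t, 1 - 1 * Real.cos t ^ 2 = Real.sin t ^ 2 := fun t => by
      rw [Real.cos_sq']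
      ring
    simp only [hs]
    refine tendsto_nhdsWithin_iff.2 ⟨?_, (eventually_sin_ne_zero j).mono fun t ht => ?_⟩
    · have hc : Continuous fun t => Real.sin t ^ 2 := by fun_prop
      have := hc.tendsto (j * Real.pi)
      rw [Real.sin_nat_mul_pi, zero_pow two_ne_zero] at this
      exact this.mono_left nhdsWithin_le_nhds
    · exact mem_Ioi.2 (by positivity)
  refine (h1.pos_mul_atTop one_pos h2.inv_tendsto_nhdsGT_zero).congr fun t => ?_
  simp only [Pi.inv_apply, slopeAt]
  ring

theorem hasDerivTop_nodalWave {κ : ℝ} (hκ : 0 < κ) {n : ℕ} (hn : 1 ≤ n) {ν : ℝ} (hν : ν ^ 2 = 1)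
    {j : ℕ} (hj : j ≤ n) :
    HasDerivTop (fun x => ν * (-1) ^ j * nodalWave κ n ν 1 x) ((j : ℝ) / n) := by
  have hm : (1 : ℝ) ∈ Icc (0 : ℝ) 1 := by simp
  have hn' : (0 : ℝ) < n := by exact_mod_cast hn
  have hP := hump_pos hm
  have hk : 0 < n * hump 1 := by positivity
  have hsub : Ioo (0 : ℝ) 1 \ {(j : ℝ) / n} ⊆ {(j : ℝ) / n}ᶜ := fun x hx => hx.2
  have hang : Tendsto (fun x => angle 1 (n * hump 1 * x + 0)) (𝓝[≠] ((j : ℝ) / n))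
      (𝓝[≠] (j * Real.pi)) := by
    have hc : Continuous fun x => angle 1 (n * hump 1 * x + 0) :=
      (continuous_angle hm).comp (by fun_prop)
    have he : angle 1 (n * hump 1 * ((j : ℝ) / n) + 0) = j * Real.pi := by
      have h1 : n * hump 1 * ((j : ℝ) / n) + 0 = ((j : ℤ) : ℝ) * hump 1 := by
        push_cast
        field_simp
        ring
      rw [h1, angle_int_mul_hump hm]
      norm_cast
    have h1 := hc.tendsto ((j : ℝ) / n)
    refine tendsto_nhdsWithin_iff.2 ⟨(he ▸ h1).mono_left nhdsWithin_le_nhds,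
      eventually_nhdsWithin_of_forall fun x hx hx' => hx ?_⟩
    have h2 := (strictMono_angle hm).injective (Eq.trans hx' he.symm)
    exact mul_left_cancel₀ hk.ne' (add_right_cancel h2)
  have hder : ∀ᶠ x in 𝓝[≠] ((j : ℝ) / n),
      HasDerivAt (fun x => ν * (-1) ^ j * nodalWave κ n ν 1 x)
        (√(1 / κ) * ((-1) ^ j * slopeAt 1 (angle 1 (n * hump 1 * x + 0)))) x := by
    filter_upwards [hang.eventually (eventually_sin_ne_zero j)] with x hx
    refine ((hasDerivAt_wave (ν * √(1 / κ)) hk.ne' hm 0 (Or.inr hx)).const_mul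
      (ν * (-1) ^ j)).congr_deriv ?_
    linear_combination √(1 / κ) * (-1) ^ j * slopeAt 1 (angle 1 (n * hump 1 * x + 0)) * hν
  have hlim := ((tendsto_slopeAt_one j).comp hang).const_mul_atTop
    (Real.sqrt_pos.2 (by positivity : 0 < 1 / κ))
  have htop : Tendsto (deriv fun x => ν * (-1) ^ j * nodalWave κ n ν 1 x)
      (𝓝[Ioo 0 1 \ {(j : ℝ) / n}] ((j : ℝ) / n)) atTop :=
    (hlim.congr' (hder.mono fun x hx => hx.deriv.symm)).mono_left (nhdsWithin_mono _ hsub)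
  refine ⟨tendsto_slope_atTop
    (continuous_const.mul (continuous_nodalWave κ n ν hm)).continuousOn
    (nodes_subset hn ⟨j, hj, rfl⟩) ?_ htop, htop⟩
  exact nhdsWithin_mono _ hsub (hder.mono fun x hx => hx.differentiableAt)

theorem isSolutionOff_nodalWave {κ : ℝ} (hκ : 0 < κ) {n : ℕ} (hn : 1 ≤ n) {ν : ℝ}
    (hν : ν ^ 2 = 1) :
    IsSolutionOff κ (8 * (n : ℝ) ^ 2 * B ^ 2) (nodes n) (nodalWave κ n ν 1) := by
  have hm : (1 : ℝ) ∈ Icc (0 : ℝ) 1 := by simp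
  have hn' : (0 : ℝ) < n := by exact_mod_cast hn
  have hP := hump_pos hm
  have hz : ∀ x ∈ Icc (0 : ℝ) 1, nodalWave κ n ν 1 x = 0 ↔ x ∈ nodes n := fun x hx =>
    nodalWave_eq_zero_iff hκ hn hν ⟨one_pos, le_rfl⟩ hx
  refine ⟨(continuous_nodalWave κ n ν hm).continuousOn, (hz 0 (by simp)).2 ⟨0, by simp⟩,
    (hz 1 (by simp)).2 ⟨n, le_rfl, by field_simp⟩, fun x hx => ?_⟩
  rw [eight_mul_B]
  refine solvesAt_wave (by positivity) hm (mul_amplitude_sq hκ hν zero_le_one) 0 (Or.inr ?_)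
  rw [add_zero, Ne, sin_angle_nat_mul_hump_eq_zero_iff hm hn (Ioo_subset_Icc_self hx.1)]
  exact hx.2

end Curvature

/-! ### The bifurcation diagram -/

theorem theorem1p1 (κ : ℝ) (hκ : 0 < κ) (n : ℕ) (hn : 1 ≤ n) (ν : ℝ) (hν : ν = 1 ∨ ν = -1) :
    -- existence
    (∀ lam : ℝ, (∃ u, Curvature.IsNodalSolution κ lam n ν u) ↔
      8 * (n : ℝ) ^ 2 * Curvature.B ^ 2 < lam ∧ lam < (n : ℝ) ^ 2 * Real.pi ^ 2) ∧
    -- uniqueness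
    (∀ (lam : ℝ) (u v : ℝ → ℝ), Curvature.IsNodalSolution κ lam n ν u →
      Curvature.IsNodalSolution κ lam n ν v → Set.EqOn u v (Set.Icc 0 1)) ∧
    -- shape: nodes, equal humps, symmetry of the first hump
    (∀ (lam : ℝ) (u : ℝ → ℝ), Curvature.IsNodalSolution κ lam n ν u →
      {x ∈ Set.Icc (0 : ℝ) 1 | u x = 0} = Curvature.nodes n ∧
      (∀ j : ℕ, j < n → ∀ x ∈ Set.Icc (0 : ℝ) (1 / n), u ((j : ℝ) / n + x) = (-1) ^ j * u x) ∧
      (∀ x ∈ Set.Icc (0 : ℝ) (1 / n), u (1 / n - x) = u x)) ∧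
    -- dependence on the parameter of the family of solutions
    (∀ u : ℝ → ℝ → ℝ,
      (∀ lam ∈ Set.Ioo (8 * (n : ℝ) ^ 2 * Curvature.B ^ 2) ((n : ℝ) ^ 2 * Real.pi ^ 2),
        Curvature.IsNodalSolution κ lam n ν (u lam)) →
      -- slope at the origin
      StrictAntiOn (fun lam => ν * derivWithin (u lam) (Set.Icc 0 1) 0)
        (Set.Ioo (8 * (n : ℝ) ^ 2 * Curvature.B ^ 2) ((n : ℝ) ^ 2 * Real.pi ^ 2)) ∧
      Filter.Tendsto (fun lam => ν * derivWithin (u lam) (Set.Icc 0 1) 0)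
        (𝓝[>] (8 * (n : ℝ) ^ 2 * Curvature.B ^ 2)) Filter.atTop ∧
      -- the sup-norm is a differentiable decreasing function of the parameter
      DifferentiableOn ℝ (fun lam => Curvature.supNorm (u lam))
        (Set.Ioo (8 * (n : ℝ) ^ 2 * Curvature.B ^ 2) ((n : ℝ) ^ 2 * Real.pi ^ 2)) ∧
      StrictAntiOn (fun lam => Curvature.supNorm (u lam))
        (Set.Ioo (8 * (n : ℝ) ^ 2 * Curvature.B ^ 2) ((n : ℝ) ^ 2 * Real.pi ^ 2)) ∧
      -- its limits at the two ends
      Filter.Tendsto (fun lam => Curvature.supNorm (u lam))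
        (𝓝[>] (8 * (n : ℝ) ^ 2 * Curvature.B ^ 2))
        (𝓝 (1 / (2 * n * Curvature.B * √κ))) ∧
      Filter.Tendsto (fun lam => Curvature.supNorm (u lam))
        (𝓝[<] ((n : ℝ) ^ 2 * Real.pi ^ 2)) (𝓝 0) ∧
      Filter.Tendsto (fun lam => u lam (1 / (2 * n)))
        (𝓝[<] ((n : ℝ) ^ 2 * Real.pi ^ 2)) (𝓝 0) ∧
      -- the singular limit solution
      ∃ U : ℝ → ℝ,
        (∀ x ∈ Set.Icc (0 : ℝ) 1, Filter.Tendsto (fun lam => u lam x)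
          (𝓝[>] (8 * (n : ℝ) ^ 2 * Curvature.B ^ 2)) (𝓝 (U x))) ∧
        Curvature.IsSolutionOff κ (8 * (n : ℝ) ^ 2 * Curvature.B ^ 2) (Curvature.nodes n) U ∧
        ∀ j : ℕ, j ≤ n →
          Curvature.HasDerivTop (fun x => ν * (-1) ^ j * U x) ((j : ℝ) / n)) := by
  have hν2 : ν ^ 2 = 1 := by rcases hν with rfl | rfl <;> norm_num
  have hn' : (0 : ℝ) < n := by exact_mod_cast hn
  have h0mem : (0 : ℝ) ∈ Icc (0 : ℝ) 1 := by simp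
  have h1mem : (1 : ℝ) ∈ Icc (0 : ℝ) 1 := by simp
  have hmono := Curvature.strictAntiOn_two_mul_hump_sq hn
  refine ⟨fun lam => ⟨?_, fun h => ?_⟩, fun lam u v hu hv => ?_, fun lam u hu => ?_,
    fun u hu => ?_⟩
  · rintro ⟨u, hu⟩
    obtain ⟨m, hm, rfl, -⟩ := hu.exists_nodalWave hκ hn hν2
    rw [Curvature.eight_mul_B, Curvature.mul_pi_sq]
    have hm' := Ioo_subset_Icc_self hm
    exact ⟨hmono hm' h1mem hm.2, hmono h0mem hm' hm.1⟩
  · obtain ⟨m, hm, rfl⟩ := Curvature.exists_two_mul_hump_sq_eq h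
    exact ⟨_, Curvature.isNodalSolution_nodalWave hκ hn hν2 hm⟩
  · obtain ⟨m, hm, hlam, hum⟩ := hu.exists_nodalWave hκ hn hν2
    obtain ⟨m', hm', hlam', hvm⟩ := hv.exists_nodalWave hκ hn hν2
    obtain rfl : m = m' := hmono.injOn (Ioo_subset_Icc_self hm) (Ioo_subset_Icc_self hm')
      (hlam.symm.trans hlam')
    exact hum.trans hvm.symm
  · obtain ⟨m, hm, -, hum⟩ := hu.exists_nodalWave hκ hn hν2
    have hm' := Ioo_subset_Icc_self hm
    have hsub : ∀ x ∈ Icc (0 : ℝ) (1 / n), x ∈ Icc (0 : ℝ) 1 := fun x hx =>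
      ⟨hx.1, hx.2.trans ((div_le_one hn').2 (by exact_mod_cast hn))⟩
    refine ⟨?_, fun j hj x hx => ?_, fun x hx => ?_⟩
    · ext x
      refine ⟨fun hx => ?_, fun hx => ⟨Curvature.nodes_subset hn hx, ?_⟩⟩
      · rw [← Curvature.nodalWave_eq_zero_iff hκ hn hν2 (Ioo_subset_Ioc_self hm) hx.1, ← hum hx.1]
        exact hx.2
      · rw [hum (Curvature.nodes_subset hn hx)]
        exact (Curvature.nodalWave_eq_zero_iff hκ hn hν2 (Ioo_subset_Ioc_self hm)
          (Curvature.nodes_subset hn hx)).2 hx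
    · have hmem : (j : ℝ) / n + x ∈ Icc (0 : ℝ) 1 := by
        have hj' : (j : ℝ) + 1 ≤ n := by exact_mod_cast hj
        refine ⟨add_nonneg (by positivity) hx.1, ?_⟩
        calc (j : ℝ) / n + x ≤ j / n + 1 / n := by linarith [hx.2]
          _ = (j + 1) / n := by ring
          _ ≤ 1 := (div_le_one hn').2 hj'
      rw [hum hmem, hum (hsub x hx), Curvature.nodalWave_add κ hn ν hm']
    · rw [hum (hsub x hx), hum (hsub _ ⟨by linarith [hx.2], by linarith [hx.1]⟩),
        Curvature.nodalWave_sub κ hn ν hm']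
  · have hex : ∀ lam, ∃ m, lam ∈ Ioo (8 * (n : ℝ) ^ 2 * Curvature.B ^ 2)
        ((n : ℝ) ^ 2 * Real.pi ^ 2) → m ∈ Ioo (0 : ℝ) 1 ∧
          2 * (n * Curvature.hump m) ^ 2 = lam ∧
          EqOn (u lam) (Curvature.nodalWave κ n ν m) (Icc 0 1) := fun lam => by
      by_cases h : lam ∈ Ioo (8 * (n : ℝ) ^ 2 * Curvature.B ^ 2) ((n : ℝ) ^ 2 * Real.pi ^ 2)
      · obtain ⟨m, hm, hlam, hum⟩ := (hu lam h).exists_nodalWave hκ hn hν2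
        exact ⟨m, fun _ => ⟨hm, hlam.symm, hum⟩⟩
      · exact ⟨0, fun h' => absurd h' h⟩
    -- `μ lam` is the parameter of the solution for `lam`, a junk value off the open interval
    choose μ hμ using hex
    have hlt : 8 * (n : ℝ) ^ 2 * Curvature.B ^ 2 < (n : ℝ) ^ 2 * Real.pi ^ 2 := by
      rw [Curvature.eight_mul_B, Curvature.mul_pi_sq]
      exact hmono h0mem h1mem one_pos
    have hbot : ∀ᶠ lam in 𝓝[>] (8 * (n : ℝ) ^ 2 * Curvature.B ^ 2),
        lam ∈ Ioo (8 * (n : ℝ) ^ 2 * Curvature.B ^ 2) ((n : ℝ) ^ 2 * Real.pi ^ 2) :=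
      Ioo_mem_nhdsGT hlt
    have htop : ∀ᶠ lam in 𝓝[<] ((n : ℝ) ^ 2 * Real.pi ^ 2),
        lam ∈ Ioo (8 * (n : ℝ) ^ 2 * Curvature.B ^ 2) ((n : ℝ) ^ 2 * Real.pi ^ 2) :=
      Ioo_mem_nhdsLT hlt
    have hμI : ∀ lam ∈ Ioo (8 * (n : ℝ) ^ 2 * Curvature.B ^ 2) ((n : ℝ) ^ 2 * Real.pi ^ 2),
        μ lam ∈ Icc (0 : ℝ) 1 := fun lam h => Ioo_subset_Icc_self (hμ lam h).1
    have hanti : ∀ a ∈ Ioo (8 * (n : ℝ) ^ 2 * Curvature.B ^ 2) ((n : ℝ) ^ 2 * Real.pi ^ 2),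
        ∀ b ∈ Ioo (8 * (n : ℝ) ^ 2 * Curvature.B ^ 2) ((n : ℝ) ^ 2 * Real.pi ^ 2),
          a < b → μ b < μ a := fun a ha b hb hab => by
      rw [← (hμ a ha).2.1, ← (hμ b hb).2.1] at hab
      exact (hmono.lt_iff_gt (hμI a ha) (hμI b hb)).1 hab
    have hμbot : Tendsto μ (𝓝[>] (8 * (n : ℝ) ^ 2 * Curvature.B ^ 2)) (𝓝 1) := by
      refine Curvature.tendsto_parameter hn (hbot.mono hμI) h1mem ?_
      rw [← Curvature.eight_mul_B]
      exact (tendsto_id.mono_left nhdsWithin_le_nhds).congr'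
        (hbot.mono fun lam h => (hμ lam h).2.1.symm)
    have hμtop : Tendsto μ (𝓝[<] ((n : ℝ) ^ 2 * Real.pi ^ 2)) (𝓝 0) := by
      refine Curvature.tendsto_parameter hn (htop.mono hμI) h0mem ?_
      rw [← Curvature.mul_pi_sq]
      exact (tendsto_id.mono_left nhdsWithin_le_nhds).congr'
        (htop.mono fun lam h => (hμ lam h).2.1.symm)
    have hslope : ∀ lam ∈ Ioo (8 * (n : ℝ) ^ 2 * Curvature.B ^ 2) ((n : ℝ) ^ 2 * Real.pi ^ 2),
        ν * derivWithin (u lam) (Icc 0 1) 0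
          = √(μ lam / κ) * (√(2 - μ lam) / (1 - μ lam)) := fun lam h =>
      Curvature.mul_derivWithin_eq hn hν2 (Ioo_subset_Ico_self (hμ lam h).1) (hμ lam h).2.2
    have hnorm : ∀ lam ∈ Ioo (8 * (n : ℝ) ^ 2 * Curvature.B ^ 2) ((n : ℝ) ^ 2 * Real.pi ^ 2),
        Curvature.supNorm (u lam) = √(μ lam / κ) / (n * Curvature.hump (μ lam)) := fun lam h =>
      Curvature.supNorm_eq hn hν2 (hμI lam h) (hμ lam h).2.2
    have hamp : ∀ {l : Filter ℝ} {m : ℝ}, m ∈ Icc (0 : ℝ) 1 → Tendsto μ l (𝓝 m) →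
        (∀ᶠ lam in l, lam ∈ Ioo (8 * (n : ℝ) ^ 2 * Curvature.B ^ 2) ((n : ℝ) ^ 2 * Real.pi ^ 2)) →
        Tendsto (fun lam => Curvature.supNorm (u lam)) l
          (𝓝 (√(m / κ) / (n * Curvature.hump m))) := fun hm hl hI =>
      ((Curvature.continuousOn_amplitude κ hn _ hm).tendsto.comp
        (tendsto_nhdsWithin_iff.2 ⟨hl, hI.mono hμI⟩)).congr'
          (hI.mono fun lam h => (hnorm lam h).symm)
    have hptw : ∀ {l : Filter ℝ} {m : ℝ}, m ∈ Icc (0 : ℝ) 1 → Tendsto μ l (𝓝 m) →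
        (∀ᶠ lam in l, lam ∈ Ioo (8 * (n : ℝ) ^ 2 * Curvature.B ^ 2) ((n : ℝ) ^ 2 * Real.pi ^ 2)) →
        ∀ x ∈ Icc (0 : ℝ) 1, Tendsto (fun lam => u lam x) l
          (𝓝 (Curvature.nodalWave κ n ν m x)) := fun hm hl hI x hx =>
      (Curvature.tendsto_nodalWave κ hn ν (hI.mono hμI) hm hl hx).congr'
        (hI.mono fun lam h => ((hμ lam h).2.2 hx).symm)
    refine ⟨fun a ha b hb hab => ?_, ?_, fun lam h => ?_, fun a ha b hb hab => ?_, ?_, ?_, ?_,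
      Curvature.nodalWave κ n ν 1, hptw h1mem hμbot hbot,
      Curvature.isSolutionOff_nodalWave hκ hn hν2,
      fun j hj => Curvature.hasDerivTop_nodalWave hκ hn hν2 hj⟩
    · simp only [hslope a ha, hslope b hb]
      exact Curvature.strictMonoOn_initialSlope hκ (Ioo_subset_Ico_self (hμ b hb).1)
        (Ioo_subset_Ico_self (hμ a ha).1) (hanti a ha b hb hab)
    · exact (Curvature.tendsto_initialSlope hκ (hbot.mono fun lam h => (hμ lam h).1.2)
        hμbot).congr' (hbot.mono fun lam h => (hslope lam h).symm)
    · refine DifferentiableAt.differentiableWithinAt ?_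
      have h1 := (Curvature.differentiableAt_amplitude hκ hn (hμ lam h).1).comp lam
        (Curvature.differentiableAt_parameter hn isOpen_Ioo
          (fun x hx => ⟨(hμ x hx).1, (hμ x hx).2.1⟩) h)
      exact h1.congr_of_eventuallyEq (eventually_of_mem (isOpen_Ioo.mem_nhds h) hnorm)
    · simp only [hnorm a ha, hnorm b hb]
      exact Curvature.strictMonoOn_amplitude hκ hn (hμI b hb) (hμI a ha) (hanti a ha b hb hab)
    · have h1 := hamp h1mem hμbot hbot
      rw [Curvature.hump_one, Real.sqrt_div zero_le_one, Real.sqrt_one, div_div] at h1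
      convert h1 using 3
      ring
    · simpa using hamp h0mem hμtop htop
    · have h1 := hptw h0mem hμtop htop (1 / (2 * n)) ⟨by positivity, by
        rw [div_le_one (by positivity)]
        have : (1 : ℝ) ≤ n := by exact_mod_cast hn
        linarith⟩
      rw [Curvature.nodalWave_half κ hn ν h0mem, zero_div, Real.sqrt_zero, zero_div, mul_zero] at h1
      exact h1
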